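/- Let $G=(V,E)$ be a directed graph (parallel links allowed) with finite link set $E$, a source $s$ and a destination $d$; let $\mathcal P$ be the set of loop-free paths from $s$ to $d$ (seen as sets of links) and $H=\max_{p\in\mathcal P}|p|$. Link $i$ has success probability $\theta_i\in(0,1]$; $\theta_{\min}=\min_{i\in E}\theta_i$. Packets $n=1,2,\dots$ are sent one after the other. The delay $d_i(n)$ (number of transmission attempts) of packet $n$ on link $i$ is geometric with mean $1/\theta_i$, and the delays of packet $n$ are independent of everything that happened before packet $n$ is sent (delays of the same packet on different links may, but need not, be independent). Put $D_\theta(p)=\sum_{i\in p}1/\theta_i$, $D^\star=\min_{p\in\mathcal P}D_\theta(p)$, $\Delta_p=D_\theta(p)-D^\star$, $\Delta_{\min}=\min\{\Delta_p:p\in\mathcal P,\ \Delta_p\neq0\}$, and assume that some $p\in\mathcal P$ has $\Delta_p\ne0$. Before packet $n$ is sent, let $s_i(n)$ be the number of packets already routed through link $i$, $t_i(n)$ the total number of transmission attempts they made on link $i$, and $\hat\theta_i(n)=s_i(n)/t_i(n)$ (and $0$ if $t_i(n)=0$). With $\mathrm{KL}(a,q)$ the Kullback–Leibler divergence between the Bernoulli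 laws of means $a$ and $q$, let $$\omega_i(n)=\min\bigl\{1/q:\ q\in(0,1],\ t_i(n)\,\mathrm{KL}(\hat\theta_i(n),q)\le \log n+3\log\log n\bigr\}.$$ The policy KL-SR sends packet $n$ on a path $p(n)\in\arg\min_{p\in\mathcal P}\sum_{i\in p}\omega_i(n)$, chosen from the feedback of the previous packets (and possibly internal randomness), ties being broken arbitrarily; the paths of packets $1$ and $2$, for which the index is not defined, are arbitrary. Its regret is $R(N)=\mathbb E\bigl[\sum_{n=1}^N\sum_{i\in p(n)}d_i(n)\bigr]-N D^\star$. There is a constant $K''\ge0$ such that for every such network and every $\theta$, for every $\epsilon\in(0,\Delta_{\min}/D^\star)$ with $\epsilon<1$ and every $N\ge3$, $$R(N)\le\frac{45\,M(\theta,\epsilon)\,|E|\,H\,(\log N+3\log\log N)}{\Delta_{\min}\theta_{\min}^3}+H\theta_{\min}^{-1}\Bigl(K''+2\epsilon^{-2}\sum_{i\in E}\theta_i^{-2}\Bigr),\qquad M(\theta,\epsilon)=\frac{(1+\epsilon)^2}{(1-\epsilon)^3(1-\epsilon D^\star/\Delta_{\min})^2}.$$ Hence $R(N)=O(|E|H\log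 N)$ as $N\to\infty$; more precisely, there is an absolute constant $C$ such that, for every such network and $\theta$, $|R(N)|\le C\,|E|H\log N/(\Delta_{\min}\theta_{\min}^3)$ for all large $N$. -/

import Mathlib

open MeasureTheory ProbabilityTheory Filter Asymptotics
open scoped ENNReal

noncomputable section

/-- A directed (multi)graph with nodes `V` and links `E`, a source and a destination. -/
structure Network (V E : Type*) where
  tail : E → V
  head : E → V
  source : V
  dest : V

namespace Network

variable {V E : Type*} (G : Network V E)

/-- The consecutive links `l` lead from the first node to the second one. -/
def IsWalk : V → List E → V → Prop
  | u, [], v => u = v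
  | u, e :: l, v => G.tail e = u ∧ IsWalk (G.head e) l v

/-- `l` is a loop-free path from the source to the destination: no node is visited twice. -/
def IsPath (l : List E) : Prop :=
  G.IsWalk G.source l G.dest ∧ (G.source :: l.map G.head).Nodup

variable [Fintype E]

open Classical in
/-- The set of loop-free paths, a path being identified with its set of links. -/
def paths : Finset (Finset E) :=
  Finset.univ.filter fun p => ∃ l : List E, G.IsPath l ∧ l.toFinset = p

/-- Length (number of links) of a longest path. -/
def maxLength : ℕ := G.paths.sup Finset.card

/-- Average delay of a path when the link success probabilities are `θ`. -/
def meanDelay (θ : E → ℝ) (p : Finset E) : ℝ := ∑ i ∈ p, 1 / θ i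

/-- Smallest average delay of a path. -/
def optDelay (θ : E → ℝ) : ℝ := sInf (meanDelay θ '' (G.paths : Set (Finset E)))

/-- Gap between the average delay of a path and the optimal one. -/
def gap (θ : E → ℝ) (p : Finset E) : ℝ := meanDelay θ p - G.optDelay θ

/-- Smallest non-zero gap. -/
def minGap (θ : E → ℝ) : ℝ := sInf {x | ∃ p ∈ G.paths, x = G.gap θ p ∧ x ≠ 0}

end Network

/-- Kullback-Leibler divergence from the Bernoulli law of mean `b` to that of mean `a`
(`a, b ∈ [0, 1]`), with the usual conventions `0 log 0 = 0` and `x log (x / 0) = ∞` for `x > 0`. -/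
def klBernoulli (a b : ℝ) : ℝ≥0∞ :=
  if (b = 0 ∧ a ≠ 0) ∨ (b = 1 ∧ a ≠ 1) then ⊤
  else ENNReal.ofReal (a * Real.log (a / b) + (1 - a) * Real.log ((1 - a) / (1 - b)))

/-- The exploration level `log n + 3 log log n`. -/
def klsrLevel (n : ℕ) : ℝ := Real.log n + 3 * Real.log (Real.log n)

/-- The smallest `1 / q` over success probabilities `q ∈ (0, 1]` compatible at round `n` with an
empirical success probability `a` obtained from `t` transmission attempts. -/
def edgeIndex (n t : ℕ) (a : ℝ) : ℝ :=
  sInf {x | ∃ q : ℝ, 0 < q ∧ q ≤ 1 ∧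
    (t : ℝ≥0∞) * klBernoulli a q ≤ ENNReal.ofReal (klsrLevel n) ∧ x = 1 / q}

section Routing

variable {V E Ω : Type*}

open Classical in
/-- Number of packets routed through link `i` before packet `n` (packets are `1, 2, …`), when
packet `m` uses the set of links `p m`. -/
def packetCount (p : ℕ → Ω → Finset E) (n : ℕ) (i : E) (x : Ω) : ℕ :=
  ∑ m ∈ Finset.Ico 1 n, if i ∈ p m x then 1 else 0

open Classical in
/-- Number of transmission attempts on link `i` before packet `n`, when `d m i` is the delay of
packet `m` on link `i`: every slot of this delay is one attempt. -/
def attemptCount (d : ℕ → E → Ω → ℕ) (p : ℕ → Ω → Finset E) (n : ℕ) (i : E) (x : Ω) : ℕ :=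
  ∑ m ∈ Finset.Ico 1 n, if i ∈ p m x then d m i x else 0

/-- Empirical success probability of link `i` before packet `n`; it is `0` if there has been no
attempt. -/
def empiricalRate (d : ℕ → E → Ω → ℕ) (p : ℕ → Ω → Finset E) (n : ℕ) (i : E) (x : Ω) : ℝ :=
  (packetCount p n i x : ℝ) / (attemptCount d p n i x : ℝ)

/-- The index of link `i` at round `n`. -/
def linkIndex (d : ℕ → E → Ω → ℕ) (p : ℕ → Ω → Finset E) (n : ℕ) (i : E) (x : Ω) : ℝ :=
  edgeIndex n (attemptCount d p n i x) (empiricalRate d p n i x)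

/-- The link delays `d n i` (packet `n ≥ 1`, link `i`) are geometric with success probabilities
`θ i`; the delays of packet `n` are independent of the information `ℱ n` available before it is
sent, and known afterwards. Delays of one packet on different links may be dependent. -/
structure IsGeometricDelays [mΩ : MeasurableSpace Ω] (μ : Measure Ω)
    (ℱ : Filtration ℕ mΩ) (θ : E → ℝ)
    (d : ℕ → E → Ω → ℕ) : Prop where
  law : ∀ n, 1 ≤ n → ∀ i, ∀ k : ℕ,
    μ {x | d n i x = k + 1} = ENNReal.ofReal (θ i * (1 - θ i) ^ k)
  adapted : ∀ n, 1 ≤ n → ∀ i, Measurable[ℱ (n + 1)] (d n i)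
  indep : ∀ n, 1 ≤ n →
    Indep (ℱ n) (MeasurableSpace.comap (fun x i => d n i x) inferInstance) μ

/-- `p` is a run of the policy: packet `n` is sent on a path that is chosen from the information
`ℱ n` (past delays, past paths, internal randomness) and minimizes the sum of the link indexes;
ties are broken arbitrarily. For `n = 1` the level `log n + 3 log log n` is undefined (`-∞`) and
for `n = 2` it is negative, so that no `q` is feasible and there is no index: the paths of the
first two packets are arbitrary. -/
structure IsKLSR [Fintype E] [mΩ : MeasurableSpace Ω]
    (ℱ : Filtration ℕ mΩ) (G : Network V E)
    (d : ℕ → E → Ω → ℕ) (p : ℕ → Ω → Finset E) : Prop where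
  mem_paths : ∀ n, 1 ≤ n → ∀ x, p n x ∈ G.paths
  predictable : ∀ n, 1 ≤ n → ∀ q, MeasurableSet[ℱ n] {x | p n x = q}
  argmin : ∀ n, 3 ≤ n → ∀ x, ∀ q ∈ G.paths,
    ∑ i ∈ p n x, linkIndex d p n i x ≤ ∑ i ∈ q, linkIndex d p n i x

/-- Expected total delay of the first `N` packets minus `N` times the optimal average delay. -/
def regret [Fintype E] [mΩ : MeasurableSpace Ω] (μ : Measure Ω) (G : Network V E) (θ : E → ℝ)
    (d : ℕ → E → Ω → ℕ) (p : ℕ → Ω → Finset E) (N : ℕ) : ℝ :=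
  (∫ x, ∑ n ∈ Finset.Icc 1 N, ∑ i ∈ p n x, (d n i x : ℝ) ∂μ) - N * G.optDelay θ

end Routing

/-- The factor `M(θ, ε)`, as a function of `ε`, the optimal delay and the smallest gap. -/
def regretFactor (ε D Δ : ℝ) : ℝ :=
  (1 + ε) ^ 2 / ((1 - ε) ^ 3 * (1 - ε * D / Δ) ^ 2)

end

/-!
The regret is the sum over packets of the expected gap of the chosen path, because the delays of a
packet are independent of the choice of its path. Write `ω` for the index of a link, `s` and `t` for
its numbers of packets and attempts, and `f` for the exploration level. When every link of the
chosen path has been used and is not overestimated by more than a factor `1 + ε`, Pinsker's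
inequality gives `1 / ((1 + ε) θ) - ω ≤ √(f / (2 θ³ s))` (`one_div_sub_edgeIndex_le`). Since the
chosen path minimizes the sum of indexes, its gap is, up to the factor
`ρ = (1 + ε) / (1 - ε D⋆ / Δmin)`, at most the total excess `(ω - 1 / θ)⁺` of the indexes on an
optimal path plus the sum of these widths on its own links (`gap_le_of_not_overestimated`). There
are then three contributions to bound.

* Widths. As the gap is at least `Δmin`, it can be replaced by twice itself minus `Δmin`, so that
  each width counts only through its part above `Δmin / H`; the sum over `s` of
  `(B / √s - x)⁺` is at most `B² / x` (`sum_posPart_div_sqrt_sub_le`). This gives the leading term.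

* Overestimated links. Likelihood ratios, discounted by a factor less than one per packet, are at
  least one whenever a link is overestimated, and the discount bounds the expectation of their sum
  over the packets of that link uniformly in time (`sum_lintegral_delayWeight_le`,
  `sum_measure_overestimated_le`).

* Index excesses. If `a = s / t` and `q < θ` is incompatible with the data, the log-likelihood is
  concave and drops by at least `f` between `a` and `q`; integrating the exponential of a chord
  shows that the uniform mixture over `r ∈ (0, θ)` of the likelihood ratios between `r` and `θ` exceeds
  `(1 / q - 1 / θ) θ (e^f - 1) / 4` (`ofReal_edgeIndex_sub_le`). The mixture has expectation one, so
  the expected excess at round `n` is at most `4 / (θ (e^f - 1))`, where `e^f = n (log n)³`, and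
  this is summable. Working with the size of the excess rather than with the probability that it is
  positive is what makes the series converge, and it costs a single factor `H`. The resulting term
  is linear in `ρ`; it is split into a constant and a multiple of `ρ²`, and the latter is absorbed
  by the leading term.

The regret is nonnegative, and for `ε = min (1, Δmin / D⋆) / 2` the factor `M(θ, ε)` is at most
`72`, which yields the asymptotic statement.
-/

/-! ### Pinsker's inequality -/

/-- Pinsker's inequality for Bernoulli laws, lower mean first. -/
theorem pinsker_bernoulli_of_le {a q : ℝ} (ha : 0 < a) (hq : q < 1) (haq : a ≤ q) :
    2 * (q - a) ^ 2 ≤ a * Real.log (a / q) + (1 - a) * Real.log ((1 - a) / (1 - q)) := by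
  have hmono : MonotoneOn
      (fun y => -(a * Real.log y) - (1 - a) * Real.log (1 - y) - 2 * (y - a) ^ 2)
      (Set.Icc a q) := by
    refine monotoneOn_of_hasDerivWithinAt_nonneg (convex_Icc a q)
      (f' := fun y => (y - a) * (1 / (y * (1 - y)) - 4)) ?_ ?_ ?_
    · refine ContinuousOn.sub (ContinuousOn.sub ?_ ?_) (by fun_prop)
      · exact ((Real.continuousOn_log.mono fun y hy => (ha.trans_le hy.1).ne').const_mul a
          |>.const_smul (-1 : ℝ)).congr fun y _ => by simp
      · refine ContinuousOn.mul continuousOn_const (ContinuousOn.log (by fun_prop) ?_)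
        intro y hy
        have := hy.2
        linarith
    · intro y hy
      rw [interior_Icc] at hy
      have hy0 : 0 < y := ha.trans hy.1
      have hy1 : 0 < 1 - y := by linarith [hy.2]
      have h1 := (Real.hasDerivAt_log hy0.ne').const_mul a
      have h2 := (((hasDerivAt_id y).const_sub 1).log hy1.ne').const_mul (1 - a)
      have h3 := ((((hasDerivAt_id y).sub_const a).pow 2).const_mul 2)
      refine ((h1.neg.sub h2).sub h3).hasDerivWithinAt.congr_deriv ?_
      simp
      field_simp
      ring
    · intro y hy
      rw [interior_Icc] at hy
      have hy0 : 0 < y := ha.trans hy.1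
      have hy1 : 0 < 1 - y := by linarith [hy.2]
      refine mul_nonneg (by linarith [hy.1]) ?_
      rw [sub_nonneg, le_div_iff₀ (by positivity)]
      nlinarith [sq_nonneg (2 * y - 1)]
  have h := hmono (Set.left_mem_Icc.2 haq) (Set.right_mem_Icc.2 haq) haq
  simp only [sub_self] at h
  rw [Real.log_div ha.ne' (by linarith), Real.log_div (by linarith) (by linarith)]
  nlinarith

theorem pinsker_bernoulli_of_ge {a q : ℝ} (ha : a < 1) (hq : 0 < q) (haq : q ≤ a) :
    2 * (q - a) ^ 2 ≤ a * Real.log (a / q) + (1 - a) * Real.log ((1 - a) / (1 - q)) := by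
  have h := pinsker_bernoulli_of_le (a := 1 - a) (q := 1 - q) (by linarith) (by linarith)
    (by linarith)
  simp only [sub_sub_cancel] at h
  nlinarith

/-- If `s` successes out of `t` attempts are compatible with the success probability `q` at level
`f`, then `1 / q` is at least `1 / b - √(f / (2 θ³ s))` for every `b ≥ max θ (s / t)`. -/
theorem one_div_sub_one_div_le {s t : ℕ} {θ b q f : ℝ} (hs : 0 < s) (hst : s ≤ t)
    (hθ : 0 < θ) (hθb : θ ≤ b) (hab : (s : ℝ) / t ≤ b) (hq : 0 < q) (hq1 : q ≤ 1)
    (hkl : (t : ℝ≥0∞) * klBernoulli ((s : ℝ) / t) q ≤ ENNReal.ofReal f) :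
    1 / b - 1 / q ≤ Real.sqrt (f / (2 * θ ^ 3)) / Real.sqrt s := by
  have hb : 0 < b := hθ.trans_le hθb
  have ht : 0 < t := hs.trans_le hst
  have hs' : (0 : ℝ) < s := by exact_mod_cast hs
  have ht' : (0 : ℝ) < t := by exact_mod_cast ht
  by_cases hqb : q ≤ b
  · have := one_div_le_one_div_of_le hq hqb
    have : (0 : ℝ) ≤ Real.sqrt (f / (2 * θ ^ 3)) / Real.sqrt s := by positivity
    linarith
  push Not at hqb
  set a : ℝ := s / t with ha_def
  have ha : 0 < a := by positivity
  have hq1' : q < 1 := by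
    rcases hq1.lt_or_eq with h | h
    · exact h
    · exfalso
      have : klBernoulli a q = ⊤ := by
        rw [klBernoulli, if_pos (Or.inr ⟨h, by linarith⟩)]
      rw [this, ENNReal.mul_top (by exact_mod_cast ht.ne')] at hkl
      simp at hkl
  have hpin := pinsker_bernoulli_of_le ha hq1' (by linarith : a ≤ q)
  have hkl' : t * (2 * (q - a) ^ 2) ≤ f := by
    rw [klBernoulli, if_neg (by rintro (h | h) <;> linarith [h.1]), ← ENNReal.ofReal_natCast,
      ← ENNReal.ofReal_mul ht'.le, ENNReal.ofReal_le_ofReal_iff'] at hkl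
    have h1 := mul_le_mul_of_nonneg_left hpin ht'.le
    rcases hkl with h | h
    · exact h1.trans h
    · have : 0 < t * (2 * (q - a) ^ 2) := by
        have : 0 < q - a := by linarith
        positivity
      linarith
  have hf : 0 ≤ f := le_trans (by positivity) hkl'
  have hta : s ≤ t * b := by
    have := mul_le_mul_of_nonneg_left hab ht'.le
    rwa [ha_def, mul_div_cancel₀ _ ht'.ne'] at this
  have hsq : 2 * s * (q - b) ^ 2 ≤ f * b := by
    have h1 : (q - b) ^ 2 ≤ (q - a) ^ 2 := by
      apply pow_le_pow_left₀ <;> linarith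
    calc 2 * s * (q - b) ^ 2 ≤ 2 * (t * b) * (q - a) ^ 2 := by gcongr
      _ = t * (2 * (q - a) ^ 2) * b := by ring
      _ ≤ f * b := by gcongr
  rw [← Real.sqrt_div' _ hs'.le]
  apply Real.le_sqrt_of_sq_le
  have h2 : 1 / b - 1 / q = (q - b) / (b * q) := by field_simp
  rw [h2, div_pow, div_div, div_le_div_iff₀ (by positivity) (by positivity)]
  have h3 : θ ^ 3 ≤ b ^ 3 := by gcongr
  have h4 : b ^ 2 ≤ q ^ 2 := by gcongr
  calc (q - b) ^ 2 * (2 * θ ^ 3 * s) = (2 * s * (q - b) ^ 2) * θ ^ 3 := by ring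
    _ ≤ (f * b) * b ^ 3 := by gcongr
    _ = f * (b ^ 2 * b ^ 2) := by ring
    _ ≤ f * (b ^ 2 * q ^ 2) := by gcongr
    _ = f * (b * q) ^ 2 := by ring

/-! ### The link index -/

theorem klBernoulli_self {a : ℝ} (ha : 0 < a) : klBernoulli a a = 0 := by
  rw [klBernoulli, if_neg (by rintro (h | h) <;> exact h.2 h.1), div_self ha.ne']
  by_cases h : 1 - a = 0
  · simp [h]
  · simp [div_self h]

theorem bddBelow_edgeIndex_set (n t : ℕ) (a : ℝ) :
    BddBelow {x | ∃ q : ℝ, 0 < q ∧ q ≤ 1 ∧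
      (t : ℝ≥0∞) * klBernoulli a q ≤ ENNReal.ofReal (klsrLevel n) ∧ x = 1 / q} := by
  refine ⟨0, ?_⟩
  rintro x ⟨q, hq, -, -, rfl⟩
  positivity

theorem edgeIndex_le {n t : ℕ} {a q : ℝ} (hq : 0 < q) (hq1 : q ≤ 1)
    (hkl : (t : ℝ≥0∞) * klBernoulli a q ≤ ENNReal.ofReal (klsrLevel n)) :
    edgeIndex n t a ≤ 1 / q :=
  csInf_le (bddBelow_edgeIndex_set n t a) ⟨q, hq, hq1, hkl, rfl⟩

theorem edgeIndex_le_of_pos {n t : ℕ} {a : ℝ} (ha : 0 < a) (ha1 : a ≤ 1) :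
    edgeIndex n t a ≤ 1 / a :=
  edgeIndex_le ha ha1 (by rw [klBernoulli_self ha]; simp)

theorem edgeIndex_zero_attempts_le (n : ℕ) (a : ℝ) : edgeIndex n 0 a ≤ 1 := by
  simpa using edgeIndex_le (n := n) (t := 0) (a := a) one_pos le_rfl (by simp)

/-- The index is not much smaller than the mean delay, unless the empirical success probability
is an overestimate. -/
theorem one_div_sub_edgeIndex_le {n s t : ℕ} {θ b : ℝ} (hs : 0 < s) (hst : s ≤ t)
    (hθ : 0 < θ) (hθb : θ ≤ b) (hab : (s : ℝ) / t ≤ b) :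
    1 / b - edgeIndex n t ((s : ℝ) / t) ≤
      Real.sqrt (klsrLevel n / (2 * θ ^ 3)) / Real.sqrt s := by
  have hs' : (0 : ℝ) < s := by exact_mod_cast hs
  have ht' : (0 : ℝ) < t := by exact_mod_cast hs.trans_le hst
  have hpos : (0 : ℝ) < s / t := by positivity
  have hle : (s : ℝ) / t ≤ 1 := by
    rw [div_le_one ht']
    exact_mod_cast hst
  rw [sub_le_comm]
  refine le_csInf ⟨_, _, hpos, hle, by rw [klBernoulli_self hpos]; simp, rfl⟩ ?_
  rintro x ⟨q, hq, hq1, hkl, rfl⟩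
  rw [sub_le_comm]
  exact one_div_sub_one_div_le hs hst hθ hθb hab hq hq1 hkl

/-! ### Excess of the index and likelihood mixtures -/

/-- A concave function which drops by `f` between `a` and `q < θ` stays, on `[a, q]`, above a line
through `(θ, h θ)` of slope at least `f / (q - a)` in absolute value; hence a lower bound on the
integral of its exponential. -/
theorem ofReal_le_lintegral_exp_of_concaveOn {h : ℝ → ℝ} (hc : ConcaveOn ℝ (Set.Ioo 0 1) h)
    {a q θ f : ℝ} (ha : 0 < a) (haq : a < q) (hqθ : q < θ) (hθ : θ < 1) (hf : 1 ≤ f)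
    (hfh : f ≤ h a - h q) :
    ENNReal.ofReal ((1 / q - 1 / θ) * (θ ^ 2 * (Real.exp f - 1) / 4)) ≤
      ∫⁻ r in Set.Ioo 0 θ, ENNReal.ofReal (Real.exp (h r - h θ)) := by
  have hq : 0 < q := ha.trans haq
  have hθ0 : 0 < θ := hq.trans hqθ
  have hqa : 0 < q - a := sub_pos.2 haq
  have hqθ' : 0 < θ - q := sub_pos.2 hqθ
  have haI : a ∈ Set.Ioo (0 : ℝ) 1 := ⟨ha, by linarith⟩
  have hqI : q ∈ Set.Ioo (0 : ℝ) 1 := ⟨hq, by linarith⟩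
  have hθI : θ ∈ Set.Ioo (0 : ℝ) 1 := ⟨hθ0, hθ⟩
  set σ : ℝ := (h a - h q) / (q - a) with hσ_def
  have hF : σ * (q - a) = h a - h q := div_mul_cancel₀ _ hqa.ne'
  have hσ : 0 < σ := div_pos (by linarith) hqa
  have hσq : 1 ≤ σ * q := by nlinarith
  have hchord : ∀ r ∈ Set.Ioc a q, σ * (θ - r) ≤ h r - h θ := by
    intro r hr
    have h1 : σ * (θ - q) ≤ h q - h θ := by
      have := hc.slope_anti_adjacent haI hθI haq hqθ
      rw [div_le_iff₀ hqθ'] at this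
      have h2 : (h q - h a) / (q - a) = -σ := by rw [hσ_def, ← neg_div]; ring
      rw [h2] at this
      linarith
    have h2 : σ * (q - r) ≤ h r - h q := by
      have h3 := hc.2 haI hqI
        (show 0 ≤ (q - r) / (q - a) from div_nonneg (by linarith [hr.2]) hqa.le)
        (show 0 ≤ (r - a) / (q - a) from div_nonneg (by linarith [hr.1]) hqa.le)
        (by field_simp; ring)
      have h4 : ((q - r) / (q - a)) • a + ((r - a) / (q - a)) • q = r := by
        simp only [smul_eq_mul]
        field_simp
        ring
      rw [h4] at h3
      simp only [smul_eq_mul] at h3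
      have h5 : (q - r) / (q - a) * h a + (r - a) / (q - a) * h q = σ * (q - r) + h q := by
        rw [hσ_def]
        field_simp
        ring
      linarith
    linarith
  have hint : ∫ r in a..q, Real.exp (σ * (θ - r)) =
      Real.exp (σ * (θ - q)) * (Real.exp (σ * (q - a)) - 1) / σ := by
    have hd : ∀ r ∈ Set.uIcc a q,
        HasDerivAt (fun r => -(Real.exp (σ * (θ - r)) / σ)) (Real.exp (σ * (θ - r))) r := by
      intro r _
      have h1 : HasDerivAt (fun r => σ * (θ - r)) (σ * -1) r :=
        ((hasDerivAt_id r).const_sub θ).const_mul σ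
      refine ((h1.exp).div_const σ).neg.congr_deriv ?_
      field_simp
    rw [intervalIntegral.integral_eq_sub_of_hasDerivAt hd
      (Continuous.intervalIntegrable (by fun_prop) _ _)]
    have : Real.exp (σ * (θ - a)) = Real.exp (σ * (θ - q)) * Real.exp (σ * (q - a)) := by
      rw [← Real.exp_add]
      congr 1
      ring
    rw [this]
    ring
  calc ENNReal.ofReal ((1 / q - 1 / θ) * (θ ^ 2 * (Real.exp f - 1) / 4))
      ≤ ENNReal.ofReal (∫ r in a..q, Real.exp (σ * (θ - r))) := by
        apply ENNReal.ofReal_le_ofReal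
        rw [hint]
        set y := σ * (θ - q) with hy
        have hy0 : 0 < y := by positivity
        have hc0 : 0 < Real.exp f - 1 := by
          have := Real.add_one_le_exp f
          linarith
        have hc1 : Real.exp f - 1 ≤ Real.exp (σ * (q - a)) - 1 := by
          rw [hF]
          gcongr
        have hey : (θ - q) * θ / (4 * q) ≤ Real.exp y / σ := by
          have hquad := Real.quadratic_le_exp_of_nonneg hy0.le
          rw [div_le_div_iff₀ (by positivity) hσ]
          by_cases hcase : θ ≤ 2 * q
          · calc (θ - q) * θ * σ = y * θ := by rw [hy]; ring
              _ ≤ y * (4 * q) := by gcongr; linarith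
              _ ≤ Real.exp y * (4 * q) := by gcongr; nlinarith
          · push Not at hcase
            calc (θ - q) * θ * σ = y * θ := by rw [hy]; ring
              _ ≤ y * (2 * (θ - q)) := by gcongr; linarith
              _ ≤ y * (2 * (θ - q)) * (σ * q) := le_mul_of_one_le_right (by positivity) hσq
              _ = y ^ 2 / 2 * (4 * q) := by rw [hy]; ring
              _ ≤ Real.exp y * (4 * q) := by gcongr; nlinarith
        have hleft : (1 / q - 1 / θ) * (θ ^ 2 * (Real.exp f - 1) / 4) =
            (θ - q) * θ / (4 * q) * (Real.exp f - 1) := by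
          field_simp
        rw [hleft]
        calc (θ - q) * θ / (4 * q) * (Real.exp f - 1)
            ≤ Real.exp y / σ * (Real.exp (σ * (q - a)) - 1) := by gcongr
          _ = _ := by ring
    _ = ∫⁻ r in Set.Ioc a q, ENNReal.ofReal (Real.exp (σ * (θ - r))) := by
        rw [intervalIntegral.integral_of_le haq.le]
        refine ofReal_integral_eq_lintegral_ofReal ?_ (ae_of_all _ fun r => (Real.exp_pos _).le)
        exact (Continuous.integrableOn_Icc (by fun_prop)).mono_set Set.Ioc_subset_Icc_self
    _ ≤ ∫⁻ r in Set.Ioc a q, ENNReal.ofReal (Real.exp (h r - h θ)) := by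
        refine setLIntegral_mono' measurableSet_Ioc fun r hr => ?_
        exact ENNReal.ofReal_le_ofReal (Real.exp_le_exp.2 (hchord r hr))
    _ ≤ _ := by
        refine lintegral_mono_set fun r hr => ⟨ha.trans hr.1, hr.2.trans_lt hqθ⟩

theorem concaveOn_logLikelihood (s u : ℕ) :
    ConcaveOn ℝ (Set.Ioo 0 1) (fun r : ℝ => s * Real.log r + u * Real.log (1 - r)) := by
  have h1 : ConcaveOn ℝ (Set.Ioo 0 1) Real.log :=
    strictConcaveOn_log_Ioi.concaveOn.subset (fun r hr => hr.1) (convex_Ioo 0 1)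
  have h2 : ConcaveOn ℝ (Set.Ioo (0 : ℝ) 1) (fun r => Real.log (1 - r)) := by
    refine ⟨convex_Ioo 0 1, fun x hx y hy a b ha hb hab => ?_⟩
    have := strictConcaveOn_log_Ioi.concaveOn.2 (x := 1 - x) (y := 1 - y)
      (by simpa using hx.2) (by simpa using hy.2) ha hb hab
    convert this using 2
    simp only [smul_eq_mul]
    linear_combination (-1 : ℝ) * hab
  exact (h1.smul (Nat.cast_nonneg s)).add (h2.smul (Nat.cast_nonneg u))

/-- Likelihood ratio, between the success probabilities `r` and `θ`, of `s` successes in `t`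
attempts. -/
noncomputable def likelihoodRatio (θ r : ℝ) (s t : ℕ) : ℝ :=
  (r / θ) ^ s * ((1 - r) / (1 - θ)) ^ (t - s)

theorem likelihoodRatio_eq_exp {θ r : ℝ} (hθ0 : 0 < θ) (hθ1 : θ < 1) (hr0 : 0 < r) (hr1 : r < 1)
    (s t : ℕ) :
    likelihoodRatio θ r s t =
      Real.exp ((s * Real.log r + (t - s : ℕ) * Real.log (1 - r)) -
        (s * Real.log θ + (t - s : ℕ) * Real.log (1 - θ))) := by
  have e : (s * Real.log r + (t - s : ℕ) * Real.log (1 - r)) -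
        (s * Real.log θ + (t - s : ℕ) * Real.log (1 - θ)) =
      s * Real.log (r / θ) + (t - s : ℕ) * Real.log ((1 - r) / (1 - θ)) := by
    rw [Real.log_div hr0.ne' hθ0.ne', Real.log_div (by linarith) (by linarith)]
    ring
  have h1 : 0 < (1 - r) / (1 - θ) := div_pos (by linarith) (by linarith)
  rw [e, Real.exp_add, Real.exp_nat_mul, Real.exp_nat_mul, Real.exp_log (by positivity),
    Real.exp_log h1, likelihoodRatio]

/-- The index exceeds the mean delay `1 / θ` by at most a multiple of the mixture over `r ∈ (0, θ)`
of the likelihood ratios, which has expectation one. -/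
theorem ofReal_edgeIndex_sub_le {n s t : ℕ} {θ : ℝ} (hs : 0 < s) (hst : s ≤ t)
    (hθ0 : 0 < θ) (hθ1 : θ < 1) (hf : 1 ≤ klsrLevel n) :
    ENNReal.ofReal (edgeIndex n t ((s : ℝ) / t) - 1 / θ) ≤
      ENNReal.ofReal (4 / (θ ^ 2 * (Real.exp (klsrLevel n) - 1))) *
        ∫⁻ r in Set.Ioo 0 θ, ENNReal.ofReal (likelihoodRatio θ r s t) := by
  have hs' : (0 : ℝ) < s := by exact_mod_cast hs
  have ht' : (0 : ℝ) < t := by exact_mod_cast hs.trans_le hst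
  set f := klsrLevel n with hf_def
  set a : ℝ := s / t with ha_def
  have ha : 0 < a := by positivity
  have ha1 : a ≤ 1 := by
    rw [ha_def, div_le_one ht']
    exact_mod_cast hst
  have hc0 : 0 < θ ^ 2 * (Real.exp f - 1) / 4 := by
    have := Real.add_one_le_exp f
    have : 0 < Real.exp f - 1 := by linarith
    positivity
  -- Every `x` strictly between `1 / θ` and the index is `1 / q` for an incompatible `q < θ`.
  refine le_of_forall_lt fun c hcω => ?_
  obtain ⟨x, hcx, hxω⟩ := exists_between hcω
  have hxtop : x ≠ ⊤ := (hxω.trans_le le_top).ne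
  lift x to NNReal using hxtop
  refine hcx.trans_le ?_
  have hx0 : (0 : ℝ) < x := by
    have : (0 : ℝ≥0∞) < x := (zero_le).trans_lt hcx
    exact_mod_cast this
  have hxω' : 1 / θ + x < edgeIndex n t a := by
    rw [← ENNReal.ofReal_coe_nnreal, ENNReal.ofReal_lt_ofReal_iff'] at hxω
    linarith [hxω.1]
  set q : ℝ := 1 / (1 / θ + x) with hq_def
  have hq : 0 < q := by positivity
  have hq_inv : 1 / q = 1 / θ + x := by rw [hq_def, one_div_one_div]
  have hqθ : q < θ := by
    rw [← one_div_lt_one_div hθ0 hq, hq_inv]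
    linarith
  have haq : a < q := by
    rw [← one_div_lt_one_div hq ha, hq_inv]
    exact hxω'.trans_le (edgeIndex_le_of_pos ha ha1)
  have hkl : ¬ ((t : ℝ≥0∞) * klBernoulli a q ≤ ENNReal.ofReal f) := by
    intro hcon
    have := edgeIndex_le hq (by linarith) hcon
    linarith
  rw [klBernoulli, if_neg (by rintro (h | h) <;> linarith [h.1]), ← ENNReal.ofReal_natCast,
    ← ENNReal.ofReal_mul ht'.le, ENNReal.ofReal_le_ofReal_iff', not_or] at hkl
  have hlog : t * (a * Real.log (a / q) + (1 - a) * Real.log ((1 - a) / (1 - q))) =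
      (s * Real.log a + (t - s : ℕ) * Real.log (1 - a)) -
        (s * Real.log q + (t - s : ℕ) * Real.log (1 - q)) := by
    rw [Real.log_div ha.ne' hq.ne', Real.log_div (x := 1 - a) (y := 1 - q) (by linarith)
      (by linarith), Nat.cast_sub hst]
    have h1 : t * a = s := mul_div_cancel₀ _ ht'.ne'
    have h2 : t * (1 - a) = t - s := by rw [mul_sub, h1, mul_one]
    linear_combination (Real.log a - Real.log q) * h1 +
      (Real.log (1 - a) - Real.log (1 - q)) * h2
  rw [hlog] at hkl
  have key := ofReal_le_lintegral_exp_of_concaveOn (concaveOn_logLikelihood s (t - s)) ha haq hqθ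
    hθ1 hf (not_le.1 hkl.1).le
  have hint : ∫⁻ r in Set.Ioo 0 θ, ENNReal.ofReal (likelihoodRatio θ r s t) =
      ∫⁻ r in Set.Ioo 0 θ, ENNReal.ofReal
        (Real.exp ((s * Real.log r + (t - s : ℕ) * Real.log (1 - r)) -
        (s * Real.log θ + (t - s : ℕ) * Real.log (1 - θ)))) := by
    refine setLIntegral_congr_fun measurableSet_Ioo fun r hr => ?_
    rw [likelihoodRatio_eq_exp hθ0 hθ1 hr.1 (hr.2.trans hθ1)]
  rw [hint]
  have hx : (x : ℝ≥0∞) = ENNReal.ofReal (4 / (θ ^ 2 * (Real.exp f - 1))) *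
      ENNReal.ofReal ((1 / q - 1 / θ) * (θ ^ 2 * (Real.exp f - 1) / 4)) := by
    have hc1 : 0 < θ ^ 2 * (Real.exp f - 1) := by linarith
    rw [← ENNReal.ofReal_mul (by positivity), hq_inv, ← ENNReal.ofReal_coe_nnreal]
    congr 1
    have : Real.exp f - 1 ≠ 0 := by
      have := Real.add_one_le_exp f
      linarith
    field_simp
    ring
  rw [hx]
  gcongr

/-! ### Deterministic sums and the exploration level -/

/-- A truncated sum of `B / √s` is bounded uniformly in its number of terms. -/
theorem sum_posPart_div_sqrt_sub_le {B x : ℝ} (hB : 0 ≤ B) (hx : 0 < x) (S : ℕ) :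
    ∑ s ∈ Finset.range S, max (B / Real.sqrt s - x) 0 ≤ B ^ 2 / x := by
  have hsqrt : ∀ S : ℕ, ∑ s ∈ Finset.range (S + 1), B / Real.sqrt s ≤ 2 * B * Real.sqrt S := by
    intro S
    induction S with
    | zero => simp
    | succ k ih =>
      rw [Finset.sum_range_succ]
      have hk : (0 : ℝ) < Real.sqrt (k + 1 : ℕ) := Real.sqrt_pos.2 (by positivity)
      have h1 : Real.sqrt (k + 1 : ℕ) ^ 2 = k + 1 := by
        rw [Real.sq_sqrt (by positivity)]
        push_cast
        ring
      have h2 : Real.sqrt k ^ 2 = k := Real.sq_sqrt (by positivity)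
      have h3 : B / Real.sqrt (k + 1 : ℕ) ≤
          2 * B * (Real.sqrt (k + 1 : ℕ) - Real.sqrt k) := by
        rw [div_le_iff₀ hk]
        have : 1 ≤ 2 * (Real.sqrt (k + 1 : ℕ) - Real.sqrt k) * Real.sqrt (k + 1 : ℕ) := by
          nlinarith [sq_nonneg (Real.sqrt (k + 1 : ℕ) - Real.sqrt k)]
        nlinarith
      linarith
  induction S with
  | zero => simpa using by positivity
  | succ S ih =>
    by_cases hlast : B / Real.sqrt S - x ≤ 0
    · rw [Finset.sum_range_succ, max_eq_right hlast, add_zero]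
      exact ih
    · push Not at hlast
      rcases Nat.eq_zero_or_pos S with rfl | hS
      · simp at hlast
        linarith
      have hS' : (0 : ℝ) < Real.sqrt S := Real.sqrt_pos.2 (by exact_mod_cast hS)
      -- All terms of index `s ≥ 1` are positive, as the last one is.
      have h1 : ∑ s ∈ Finset.range (S + 1), max (B / Real.sqrt s - x) 0 ≤
          ∑ s ∈ Finset.range (S + 1), (B / Real.sqrt s - if s = 0 then 0 else x) := by
        refine Finset.sum_le_sum fun s hs => ?_
        rcases Nat.eq_zero_or_pos s with rfl | hs0
        · simp [hx.le]
        · rw [if_neg hs0.ne']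
          refine max_le le_rfl (hlast.le.trans ?_)
          have : (0 : ℝ) < Real.sqrt s := Real.sqrt_pos.2 (by exact_mod_cast hs0)
          have : s ≤ S := Nat.lt_succ_iff.1 (Finset.mem_range.1 hs)
          gcongr
      have h2 : ∑ s ∈ Finset.range (S + 1), (if s = 0 then 0 else x) = S * x := by
        rw [Finset.sum_range_succ']
        simp
      rw [Finset.sum_sub_distrib, h2] at h1
      refine h1.trans ((sub_le_sub_right (hsqrt S) _).trans ?_)
      rw [le_div_iff₀ hx]
      have h3 : Real.sqrt S ^ 2 = S := Real.sq_sqrt (by positivity)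
      have h4 : Real.sqrt S ^ 2 * x ^ 2 = S * x ^ 2 := by rw [h3]
      nlinarith [sq_nonneg (B - Real.sqrt S * x)]

theorem one_le_log_of_three_le {n : ℕ} (hn : 3 ≤ n) : 1 ≤ Real.log n := by
  rw [Real.le_log_iff_exp_le (by positivity)]
  have : (3 : ℝ) ≤ n := by exact_mod_cast hn
  linarith [Real.exp_one_lt_d9]

theorem one_le_klsrLevel {n : ℕ} (hn : 3 ≤ n) : 1 ≤ klsrLevel n := by
  have h := one_le_log_of_three_le hn
  have := Real.log_nonneg h
  rw [klsrLevel]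
  linarith

theorem klsrLevel_mono {n N : ℕ} (hn : 3 ≤ n) (hnN : n ≤ N) : klsrLevel n ≤ klsrLevel N := by
  have h := one_le_log_of_three_le hn
  have h1 : Real.log n ≤ Real.log N := by
    gcongr
  have h2 : Real.log (Real.log n) ≤ Real.log (Real.log N) := by
    gcongr
  rw [klsrLevel, klsrLevel]
  linarith

theorem exp_klsrLevel {n : ℕ} (hn : 3 ≤ n) :
    Real.exp (klsrLevel n) = n * Real.log n ^ 3 := by
  have h := one_le_log_of_three_le hn
  have h3 : 3 * Real.log (Real.log n) = ((3 : ℕ) : ℝ) * Real.log (Real.log n) := by norm_num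
  rw [klsrLevel, Real.exp_add, Real.exp_log (by positivity), h3, Real.exp_nat_mul,
    Real.exp_log (by linarith)]

/-- The exploration level is large enough for this series to converge; its terms are compared with
`1 / (n log² n)`, whose sum telescopes. -/
theorem sum_one_div_exp_klsrLevel_le (N : ℕ) :
    ∑ n ∈ Finset.Icc 3 N, 1 / (Real.exp (klsrLevel n) - 1) ≤ 3 := by
  have hstep : ∀ n : ℕ, 3 ≤ n → 1 / (Real.exp (klsrLevel n) - 1) ≤
      2 * (1 / Real.log (n - 1 : ℕ) - 1 / Real.log n) := by
    intro n hn
    have h1 := one_le_log_of_three_le hn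
    have hn' : (3 : ℝ) ≤ n := by exact_mod_cast hn
    have hcast : ((n - 1 : ℕ) : ℝ) = n - 1 := by
      rw [Nat.cast_sub (by omega)]
      simp
    have hl0 : 0 < Real.log (n - 1 : ℕ) := by
      rw [hcast]
      exact Real.log_pos (by linarith)
    have hl1 : Real.log (n - 1 : ℕ) ≤ Real.log n := by
      rw [hcast]
      gcongr <;> linarith
    have hdiff : 1 / (n : ℝ) ≤ Real.log n - Real.log (n - 1 : ℕ) := by
      rw [hcast, ← Real.log_div (by linarith) (by linarith)]
      have := Real.one_sub_inv_le_log_of_pos (x := (n : ℝ) / (n - 1))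
        (div_pos (by linarith) (by linarith))
      refine le_trans (le_of_eq ?_) this
      rw [inv_div]
      field_simp
      ring
    rw [exp_klsrLevel hn, div_sub_div _ _ hl0.ne' (by linarith), one_mul, mul_one,
      ← mul_div_assoc]
    have hden : 3 ≤ (n : ℝ) * Real.log n ^ 3 := by
      have : 1 ≤ Real.log n ^ 3 := one_le_pow₀ h1
      nlinarith
    rw [div_le_div_iff₀ (by linarith) (by positivity), one_mul]
    calc Real.log (n - 1 : ℕ) * Real.log n ≤ Real.log n * Real.log n := by gcongr
      _ = Real.log n ^ 2 := by ring
      _ ≤ Real.log n ^ 3 := pow_le_pow_right₀ h1 (by norm_num)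
      _ = 1 / n * (n * Real.log n ^ 3) := by field_simp
      _ ≤ 1 / n * (2 * (n * Real.log n ^ 3 - 1)) :=
        mul_le_mul_of_nonneg_left (by linarith) (by positivity)
      _ ≤ (Real.log n - Real.log (n - 1 : ℕ)) * (2 * (n * Real.log n ^ 3 - 1)) := by
        gcongr
        linarith
      _ = _ := by ring
  have hsum : ∀ N : ℕ, ∑ n ∈ Finset.Icc 3 (N + 2), 1 / (Real.exp (klsrLevel n) - 1) ≤
      2 * (1 / Real.log 2 - 1 / Real.log (N + 2 : ℕ)) := by
    intro N
    induction N with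
    | zero => simp
    | succ k ih =>
      rw [show k + 1 + 2 = (k + 2) + 1 by ring, Finset.sum_Icc_succ_top (by omega)]
      have := hstep (k + 2 + 1) (by omega)
      rw [Nat.add_sub_cancel] at this
      linarith
  have hmono : ∑ n ∈ Finset.Icc 3 N, 1 / (Real.exp (klsrLevel n) - 1) ≤
      ∑ n ∈ Finset.Icc 3 (N + 2), 1 / (Real.exp (klsrLevel n) - 1) := by
    refine Finset.sum_le_sum_of_subset_of_nonneg (Finset.Icc_subset_Icc le_rfl (by omega)) ?_
    intro n hn _
    have := Real.add_one_le_exp (klsrLevel n)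
    have := one_le_klsrLevel (Finset.mem_Icc.1 hn).1
    exact one_div_nonneg.2 (by linarith)
  refine hmono.trans ((hsum N).trans ?_)
  have h1 : 0 ≤ 1 / Real.log (N + 2 : ℕ) := one_div_nonneg.2 (Real.log_natCast_nonneg _)
  have h2 : 1 / Real.log 2 ≤ 3 / 2 := by
    rw [div_le_div_iff₀ (Real.log_pos (by norm_num)) (by norm_num)]
    linarith [Real.log_two_gt_d9]
  linarith

/-! ### Discounted likelihood ratios -/

/-- Per-packet discount factor of the tilted likelihood ratio that detects an empirical success
probability above `b`. -/
noncomputable def tiltFactor (θ b : ℝ) : ℝ :=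
  Real.exp (-(b * Real.log (b / θ) + (1 - b) * Real.log ((1 - b) / (1 - θ))) / b)

/-- The discounted likelihood ratio is at least one when the empirical rate is at least `b`. -/
theorem one_le_tiltFactor_pow_mul_likelihoodRatio {θ b : ℝ} (hθ : 0 < θ) (hθb : θ ≤ b) (hb : b < 1)
    {s t : ℕ} (hst : s ≤ t) (h : (t : ℝ) * b ≤ s) :
    1 ≤ tiltFactor θ b ^ s * likelihoodRatio θ b s t := by
  have hb0 : 0 < b := hθ.trans_le hθb
  rw [likelihoodRatio_eq_exp hθ (hθb.trans_lt hb) hb0 hb, tiltFactor, ← Real.exp_nat_mul,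
    ← Real.exp_add, Real.one_le_exp_iff, Real.log_div hb0.ne' hθ.ne',
    Real.log_div (by linarith) (by linarith), Nat.cast_sub hst]
  have h1 : Real.log (1 - b) ≤ Real.log (1 - θ) := Real.log_le_log (by linarith) (by linarith)
  have h2 : 0 ≤ (s - t * b) * (Real.log (1 - θ) - Real.log (1 - b)) :=
    mul_nonneg (by linarith) (by linarith)
  have h3 : (s : ℝ) * (-(b * (Real.log b - Real.log θ) +
      (1 - b) * (Real.log (1 - b) - Real.log (1 - θ))) / b) +
      (s * Real.log b + (t - s) * Real.log (1 - b) -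
        (s * Real.log θ + (t - s) * Real.log (1 - θ))) =
      (s - t * b) * (Real.log (1 - θ) - Real.log (1 - b)) / b := by
    field_simp
    ring
  rw [h3]
  positivity

theorem tiltFactor_le {θ ε : ℝ} (hθ : 0 < θ) (hε : 0 < ε) (hb : (1 + ε) * θ < 1) :
    tiltFactor θ ((1 + ε) * θ) ≤ Real.exp (-(2 * (ε ^ 2 * θ ^ 2))) := by
  set b := (1 + ε) * θ with hb_def
  have hθb : θ ≤ b := by nlinarith
  have hb0 : 0 < b := by positivity
  rw [tiltFactor, Real.exp_le_exp, neg_div, neg_le_neg_iff, le_div_iff₀ hb0]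
  have := pinsker_bernoulli_of_ge hb hθ hθb
  have h2 : θ - b = -(ε * θ) := by rw [hb_def]; ring
  rw [h2] at this
  have h3 : 0 < ε ^ 2 * θ ^ 2 := by positivity
  nlinarith

theorem half_le_one_sub_exp_neg {x : ℝ} (hx0 : 0 ≤ x) (hx1 : x ≤ 1) :
    x / 2 ≤ 1 - Real.exp (-(2 * x)) := by
  have h1 := Real.add_one_le_exp (2 * x)
  have h2 : Real.exp (-(2 * x)) ≤ 1 / (1 + 2 * x) := by
    rw [Real.exp_neg, inv_eq_one_div]
    gcongr
    linarith
  have h3 : 1 / (1 + 2 * x) ≤ 1 - x / 2 := by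
    rw [div_le_iff₀ (by linarith)]
    nlinarith
  linarith

/-! ### Counting packets and attempts -/

section Counting

variable {E Ω : Type*} {d : ℕ → E → Ω → ℕ} {p : ℕ → Ω → Finset E} {i : E} {x : Ω}

open Classical in
theorem packetCount_succ {n : ℕ} (hn : 1 ≤ n) :
    packetCount p (n + 1) i x = packetCount p n i x + if i ∈ p n x then 1 else 0 := by
  rw [packetCount, Finset.sum_Ico_succ_top hn, packetCount]

open Classical in
theorem attemptCount_succ {n : ℕ} (hn : 1 ≤ n) :
    attemptCount d p (n + 1) i x =
      attemptCount d p n i x + if i ∈ p n x then d n i x else 0 := by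
  rw [attemptCount, Finset.sum_Ico_succ_top hn, attemptCount]

theorem packetCount_le_attemptCount (hd : ∀ m, 1 ≤ m → 1 ≤ d m i x) (n : ℕ) :
    packetCount p n i x ≤ attemptCount d p n i x := by
  refine Finset.sum_le_sum fun m hm => ?_
  split_ifs
  · exact hd m (Finset.mem_Ico.1 hm).1
  · exact le_rfl

theorem notMem_of_packetCount_eq_zero {n m : ℕ} (h : packetCount p n i x = 0)
    (hm : m ∈ Finset.Ico 1 n) : i ∉ p m x := by
  intro hi
  have := Finset.sum_eq_zero_iff.1 h m hm
  simp [hi] at this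

theorem attemptCount_eq_zero {n : ℕ} (h : packetCount p n i x = 0) :
    attemptCount d p n i x = 0 :=
  Finset.sum_eq_zero fun _ hm => if_neg (notMem_of_packetCount_eq_zero h hm)

open Classical in
/-- Summing over the packets routed through a link amounts to summing over their ranks. -/
theorem sum_ite_packetCount {M : Type*} [AddCommMonoid M] (φ : ℕ → M) {N : ℕ} (hN : 1 ≤ N) :
    ∑ n ∈ Finset.Ico 1 N, (if i ∈ p n x then φ (packetCount p n i x) else 0) =
      ∑ s ∈ Finset.range (packetCount p N i x), φ s := by
  induction N, hN using Nat.le_induction with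
  | base => simp [packetCount]
  | succ n hn ih =>
    rw [Finset.sum_Ico_succ_top hn, ih, packetCount_succ hn]
    split_ifs
    · rw [Finset.sum_range_succ]
    · simp

open Classical in
/-- Product of the weights `g` of the delays of the packets routed through link `i` before
packet `n`. -/
noncomputable def delayWeight (g : ℕ → ℝ≥0∞) (d : ℕ → E → Ω → ℕ) (p : ℕ → Ω → Finset E) (i : E)
    (n : ℕ) (x : Ω) : ℝ≥0∞ :=
  ∏ m ∈ Finset.Ico 1 n, if i ∈ p m x then g (d m i x) else 1

open Classical in
theorem delayWeight_succ (g : ℕ → ℝ≥0∞) {n : ℕ} (hn : 1 ≤ n) :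
    delayWeight g d p i (n + 1) x =
      delayWeight g d p i n x * if i ∈ p n x then g (d n i x) else 1 := by
  rw [delayWeight, Finset.prod_Ico_succ_top hn, delayWeight]

/-- Weight of a delay of `k` attempts whose products are the discounted likelihood ratios. The
value at `k = 0`, where `k - 1` is truncated, plays no role: delays are almost surely positive. -/
noncomputable def tiltedWeight (γ θ r : ℝ) (k : ℕ) : ℝ≥0∞ :=
  ENNReal.ofReal (γ * (r / θ * ((1 - r) / (1 - θ)) ^ (k - 1)))

theorem likelihoodRatio_nonneg {θ r : ℝ} (hθ0 : 0 < θ) (hθ1 : θ < 1) (hr0 : 0 < r) (hr1 : r < 1)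
    (s t : ℕ) : 0 ≤ likelihoodRatio θ r s t := by
  have : 0 < (1 - r) / (1 - θ) := div_pos (by linarith) (by linarith)
  unfold likelihoodRatio
  positivity

theorem delayWeight_tiltedWeight {γ θ r : ℝ} (hγ : 0 ≤ γ) (hθ0 : 0 < θ) (hθ1 : θ < 1)
    (hr0 : 0 < r) (hr1 : r < 1) (hd : ∀ m, 1 ≤ m → 1 ≤ d m i x) {n : ℕ} (hn : 1 ≤ n) :
    delayWeight (tiltedWeight γ θ r) d p i n x =
      ENNReal.ofReal (γ ^ packetCount p n i x *
        likelihoodRatio θ r (packetCount p n i x) (attemptCount d p n i x)) := by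
  induction n, hn using Nat.le_induction with
  | base => simp [delayWeight, packetCount, attemptCount, likelihoodRatio]
  | succ n hn ih =>
    rw [delayWeight_succ _ hn, ih, packetCount_succ hn, attemptCount_succ hn]
    split_ifs
    · have h1 := packetCount_le_attemptCount (p := p) hd n
      have h2 := hd n hn
      have h3 : attemptCount d p n i x + d n i x - (packetCount p n i x + 1) =
          attemptCount d p n i x - packetCount p n i x + (d n i x - 1) := by omega
      rw [tiltedWeight, ← ENNReal.ofReal_mul (mul_nonneg (pow_nonneg hγ _)
        (likelihoodRatio_nonneg hθ0 hθ1 hr0 hr1 _ _)), likelihoodRatio, likelihoodRatio, h3]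
      congr 1
      ring
    · simp

end Counting

/-! ### Delays and exponential martingales -/

section Delays

theorem IsGeometricDelays.measurable {E Ω : Type*}
    [mΩ : MeasurableSpace Ω] {μ : Measure Ω} {ℱ : Filtration ℕ mΩ} {θ : E → ℝ}
    {d : ℕ → E → Ω → ℕ} (hd : IsGeometricDelays μ ℱ θ d) {n : ℕ} (hn : 1 ≤ n)
    (i : E) : Measurable (d n i) :=
  (hd.adapted n hn i).mono (ℱ.le _) le_rfl

theorem measurableSet_mem_path {E Ω : Type*} [Fintype E] {m : MeasurableSpace Ω} {π : Ω → Finset E}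
    (hπ : ∀ q, MeasurableSet[m] {x | π x = q}) (i : E) : MeasurableSet[m] {x | i ∈ π x} := by
  classical
  have : {x | i ∈ π x} = ⋃ q ∈ {q : Finset E | i ∈ q}, {x | π x = q} := by
    ext x
    simp
  rw [this]
  exact MeasurableSet.biUnion (Set.to_countable _) fun q _ => hπ q

theorem measurable_packetCount {E Ω : Type*} [Fintype E] [mΩ : MeasurableSpace Ω]
    {ℱ : Filtration ℕ mΩ} {p : ℕ → Ω → Finset E}
    (hp : ∀ n, 1 ≤ n → ∀ q, MeasurableSet[ℱ n] {x | p n x = q}) (n : ℕ) (i : E) :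
    Measurable (packetCount p n i) := by
  unfold packetCount
  refine Finset.measurable_fun_sum _ fun m hm => ?_
  exact Measurable.ite (ℱ.le m _ (measurableSet_mem_path (hp m (Finset.mem_Ico.1 hm).1) i))
    measurable_const measurable_const

theorem measurable_attemptCount {E Ω : Type*} [Fintype E] [mΩ : MeasurableSpace Ω]
    {μ : Measure Ω} {ℱ : Filtration ℕ mΩ} {θ : E → ℝ} {d : ℕ → E → Ω → ℕ} {p : ℕ → Ω → Finset E}
    (hd : IsGeometricDelays μ ℱ θ d)
    (hp : ∀ n, 1 ≤ n → ∀ q, MeasurableSet[ℱ n] {x | p n x = q}) (n : ℕ) (i : E) :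
    Measurable (attemptCount d p n i) := by
  unfold attemptCount
  refine Finset.measurable_fun_sum _ fun m hm => ?_
  exact Measurable.ite (ℱ.le m _ (measurableSet_mem_path (hp m (Finset.mem_Ico.1 hm).1) i))
    (hd.measurable (Finset.mem_Ico.1 hm).1 i) measurable_const

theorem measurable_comp_counts {E Ω : Type*} [Fintype E] [mΩ : MeasurableSpace Ω]
    {μ : Measure Ω} {ℱ : Filtration ℕ mΩ} {θ : E → ℝ} {d : ℕ → E → Ω → ℕ} {p : ℕ → Ω → Finset E}
    (hd : IsGeometricDelays μ ℱ θ d)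
    (hp : ∀ n, 1 ≤ n → ∀ q, MeasurableSet[ℱ n] {x | p n x = q}) {M : Type*} [MeasurableSpace M]
    (F : ℕ × ℕ → M) (n : ℕ) (i : E) :
    Measurable fun x => F (packetCount p n i x, attemptCount d p n i x) :=
  (measurable_of_countable F).comp
    ((measurable_packetCount hp n i).prodMk (measurable_attemptCount hd hp n i))

theorem measurable_delayWeight {E Ω : Type*} [Fintype E]
    [mΩ : MeasurableSpace Ω] {μ : Measure Ω} {ℱ : Filtration ℕ mΩ} {θ : E → ℝ}
    {d : ℕ → E → Ω → ℕ} {p : ℕ → Ω → Finset E} (hd : IsGeometricDelays μ ℱ θ d)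
    (hp : ∀ n, 1 ≤ n → ∀ q, MeasurableSet[ℱ n] {x | p n x = q}) (g : ℕ → ℝ≥0∞) (i : E)
    (n : ℕ) : Measurable[ℱ n] (delayWeight g d p i n) := by
  classical
  unfold delayWeight
  refine Finset.measurable_fun_prod _ fun m hm => ?_
  obtain ⟨h1, h2⟩ := Finset.mem_Ico.1 hm
  refine Measurable.ite (measurableSet_mem_path (fun q => ℱ.mono h2.le _ (hp m h1 q)) i) ?_
    measurable_const
  exact (measurable_of_countable g).comp ((hd.adapted m h1 i).mono (ℱ.mono h2) le_rfl)

variable {E Ω : Type*} [mΩ : MeasurableSpace Ω] {μ : Measure Ω} {ℱ : Filtration ℕ mΩ} {θ : E → ℝ} {d : ℕ → E → Ω → ℕ}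

/-- The delay of packet `n` on link `i` is independent of the information available before. -/
theorem IsGeometricDelays.lintegral_mul_comp (hd : IsGeometricDelays μ ℱ θ d) {n : ℕ} (hn : 1 ≤ n)
    (i : E) {Y : Ω → ℝ≥0∞} (hY : Measurable[ℱ n] Y) (g : ℕ → ℝ≥0∞) :
    ∫⁻ x, Y x * g (d n i x) ∂μ = (∫⁻ x, Y x ∂μ) * ∫⁻ x, g (d n i x) ∂μ := by
  have hle : MeasurableSpace.comap (fun x i => d n i x) inferInstance ≤ mΩ :=
    (measurable_pi_lambda _ fun i => hd.measurable hn i).comap_le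
  refine lintegral_mul_eq_lintegral_mul_lintegral_of_independent_measurableSpace
    (ℱ.le n) hle (hd.indep n hn) hY ?_
  have h1 : Measurable[MeasurableSpace.comap (fun x i => d n i x) inferInstance]
      (fun x i => d n i x) := comap_measurable _
  exact (measurable_of_countable g).comp ((measurable_pi_apply i).comp h1)

open Classical in
theorem lintegral_delayWeight_succ [Fintype E] {p : ℕ → Ω → Finset E}
    (hd : IsGeometricDelays μ ℱ θ d)
    (hp : ∀ n, 1 ≤ n → ∀ q, MeasurableSet[ℱ n] {x | p n x = q}) (g : ℕ → ℝ≥0∞) (i : E)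
    {n : ℕ} (hn : 1 ≤ n) :
    ∫⁻ x, delayWeight g d p i (n + 1) x ∂μ =
      ∫⁻ x, (if i ∈ p n x then 0 else delayWeight g d p i n x) ∂μ +
        (∫⁻ x, (if i ∈ p n x then delayWeight g d p i n x else 0) ∂μ) *
          ∫⁻ x, g (d n i x) ∂μ := by
  have hset := measurableSet_mem_path (hp n hn) i
  have hZ := measurable_delayWeight hd hp g i n
  have hin : Measurable[ℱ n] fun x => if i ∈ p n x then delayWeight g d p i n x else 0 :=
    Measurable.ite hset hZ measurable_const
  have hout : Measurable[ℱ n] fun x => if i ∈ p n x then 0 else delayWeight g d p i n x :=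
    Measurable.ite hset measurable_const hZ
  rw [← hd.lintegral_mul_comp hn i hin g, ← lintegral_add_left (hout.mono (ℱ.le n) le_rfl)]
  refine lintegral_congr fun x => ?_
  rw [delayWeight_succ _ hn]
  split_ifs <;> simp

variable [IsProbabilityMeasure μ]

theorem hasSum_geometric_law {θ : ℝ} (hθ : 0 < θ ∧ θ ≤ 1) :
    HasSum (fun k : ℕ => θ * (1 - θ) ^ k) 1 := by
  have h := (hasSum_geometric_of_lt_one (r := 1 - θ) (by linarith) (by linarith)).mul_left θ
  rwa [sub_sub_cancel, mul_inv_cancel₀ hθ.1.ne'] at h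

theorem tsum_ofReal_of_hasSum {f : ℕ → ℝ} {a : ℝ} (hf : ∀ k, 0 ≤ f k) (h : HasSum f a) :
    ∑' k, ENNReal.ofReal (f k) = ENNReal.ofReal a := by
  rw [← h.tsum_eq, ENNReal.ofReal_tsum_of_nonneg hf h.summable]

theorem IsGeometricDelays.measure_eq_zero (hd : IsGeometricDelays μ ℱ θ d)
    (hθ : ∀ i, 0 < θ i ∧ θ i ≤ 1) {n : ℕ} (hn : 1 ≤ n) (i : E) : μ {x | d n i x = 0} = 0 := by
  have hmeas := hd.measurable hn i
  have : IsProbabilityMeasure (μ.map (d n i)) := Measure.isProbabilityMeasure_map hmeas.aemeasurable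
  have h1 : ∑' k : ℕ, μ.map (d n i) {k} = 1 := by
    have h0 := lintegral_countable' (μ := μ.map (d n i)) (fun _ : ℕ => 1)
    simpa using h0.symm
  have h2 : ∀ k : ℕ, μ.map (d n i) {k} = μ {x | d n i x = k} := fun k =>
    Measure.map_apply hmeas (measurableSet_singleton k)
  simp only [h2] at h1
  rw [tsum_eq_zero_add' ENNReal.summable] at h1
  have h3 : ∑' k : ℕ, μ {x | d n i x = k + 1} = 1 := by
    simp_rw [hd.law n hn i]
    rw [tsum_ofReal_of_hasSum (fun k => mul_nonneg (hθ i).1.le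
      (pow_nonneg (by linarith [(hθ i).2]) _)) (hasSum_geometric_law (hθ i)), ENNReal.ofReal_one]
  rw [h3] at h1
  exact (ENNReal.add_left_inj ENNReal.one_ne_top).1 (h1.trans (zero_add 1).symm)

theorem IsGeometricDelays.ae_one_le [Countable E] (hd : IsGeometricDelays μ ℱ θ d)
    (hθ : ∀ i, 0 < θ i ∧ θ i ≤ 1) : ∀ᵐ x ∂μ, ∀ i, ∀ m, 1 ≤ m → 1 ≤ d m i x := by
  rw [ae_all_iff]
  intro i
  rw [ae_all_iff]
  intro m
  by_cases hm : 1 ≤ m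
  · filter_upwards [measure_eq_zero_iff_ae_notMem.1 (hd.measure_eq_zero hθ hm i)] with x hx _
    exact Nat.one_le_iff_ne_zero.2 hx
  · exact ae_of_all _ fun x h => absurd h hm

theorem IsGeometricDelays.lintegral_comp (hd : IsGeometricDelays μ ℱ θ d)
    (hθ : ∀ i, 0 < θ i ∧ θ i ≤ 1) {n : ℕ} (hn : 1 ≤ n) (i : E) (g : ℕ → ℝ≥0∞) :
    ∫⁻ x, g (d n i x) ∂μ = ∑' k : ℕ, g (k + 1) * ENNReal.ofReal (θ i * (1 - θ i) ^ k) := by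
  have hmeas := hd.measurable hn i
  rw [← lintegral_map (f := g) (measurable_of_countable g) hmeas, lintegral_countable']
  have h2 : ∀ k : ℕ, μ.map (d n i) {k} = μ {x | d n i x = k} := fun k =>
    Measure.map_apply hmeas (measurableSet_singleton k)
  simp only [h2]
  rw [tsum_eq_zero_add' ENNReal.summable, hd.measure_eq_zero hθ hn i, mul_zero, zero_add]
  simp_rw [hd.law n hn i]

theorem IsGeometricDelays.lintegral_delay (hd : IsGeometricDelays μ ℱ θ d)
    (hθ : ∀ i, 0 < θ i ∧ θ i ≤ 1) {n : ℕ} (hn : 1 ≤ n) (i : E) :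
    ∫⁻ x, (d n i x : ℝ≥0∞) ∂μ = ENNReal.ofReal (1 / θ i) := by
  obtain ⟨h0, h1⟩ := hθ i
  rw [hd.lintegral_comp hθ hn i (fun k => (k : ℝ≥0∞))]
  have hnorm : ‖1 - θ i‖ < 1 := by
    rw [Real.norm_eq_abs, abs_lt]
    constructor <;> linarith
  have h2 := ((hasSum_coe_mul_geometric_of_norm_lt_one hnorm).mul_left (θ i)).add
    (hasSum_geometric_law (hθ i))
  have h3 : θ i * ((1 - θ i) / (1 - (1 - θ i)) ^ 2) + 1 = 1 / θ i := by
    rw [sub_sub_cancel]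
    field_simp
    ring
  rw [h3] at h2
  have h4 : ∀ k : ℕ, 0 ≤ θ i * (k * (1 - θ i) ^ k) + θ i * (1 - θ i) ^ k := fun k => by
    have : 0 ≤ 1 - θ i := by linarith
    positivity
  rw [← tsum_ofReal_of_hasSum h4 h2]
  refine tsum_congr fun k => ?_
  rw [← ENNReal.ofReal_natCast, ← ENNReal.ofReal_mul (by positivity)]
  congr 1
  push_cast
  ring

theorem IsGeometricDelays.lintegral_tiltedWeight (hd : IsGeometricDelays μ ℱ θ d)
    (hθ : ∀ i, 0 < θ i ∧ θ i ≤ 1) {n : ℕ} (hn : 1 ≤ n) {i : E} (hθ1 : θ i < 1) {γ r : ℝ}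
    (hγ : 0 ≤ γ) (hr0 : 0 < r) (hr1 : r < 1) :
    ∫⁻ x, tiltedWeight γ (θ i) r (d n i x) ∂μ = ENNReal.ofReal γ := by
  have h0 := (hθ i).1
  rw [hd.lintegral_comp hθ hn i]
  have h1 := (hasSum_geometric_law (θ := r) ⟨hr0, hr1.le⟩).mul_left γ
  rw [mul_one] at h1
  rw [← tsum_ofReal_of_hasSum (fun k => mul_nonneg hγ (mul_nonneg hr0.le
    (pow_nonneg (by linarith) _))) h1]
  refine tsum_congr fun k => ?_
  have h2 : 0 < 1 - θ i := by linarith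
  have h3 : 0 ≤ 1 - r := by linarith
  rw [tiltedWeight, ← ENNReal.ofReal_mul (by positivity), Nat.add_sub_cancel, div_pow]
  congr 1
  field_simp

variable [Fintype E] {p : ℕ → Ω → Finset E}

theorem lintegral_delayWeight_eq_one (hd : IsGeometricDelays μ ℱ θ d)
    (hp : ∀ n, 1 ≤ n → ∀ q, MeasurableSet[ℱ n] {x | p n x = q}) {g : ℕ → ℝ≥0∞} {i : E}
    (hg : ∀ n, 1 ≤ n → ∫⁻ x, g (d n i x) ∂μ = 1) {n : ℕ} (hn : 1 ≤ n) :
    ∫⁻ x, delayWeight g d p i n x ∂μ = 1 := by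
  classical
  induction n, hn using Nat.le_induction with
  | base => simp [delayWeight]
  | succ n hn ih =>
    have hset := ℱ.le n _ (measurableSet_mem_path (hp n hn) i)
    have hZ := (measurable_delayWeight hd hp g i n).mono (ℱ.le n) le_rfl
    rw [lintegral_delayWeight_succ hd hp g i hn, hg n hn, mul_one,
      ← lintegral_add_left (Measurable.ite hset measurable_const hZ), ← ih]
    refine lintegral_congr fun x => ?_
    split_ifs <;> simp

open Classical in
/-- When the weights have mean `Γ < 1`, the expected weight accumulated over the packets routed
through a link is at most `1 / (1 - Γ)`, whatever their number. -/
theorem sum_lintegral_delayWeight_le (hd : IsGeometricDelays μ ℱ θ d)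
    (hp : ∀ n, 1 ≤ n → ∀ q, MeasurableSet[ℱ n] {x | p n x = q}) {g : ℕ → ℝ≥0∞} {i : E}
    {Γ : ℝ≥0∞} (hΓ : Γ ≤ 1) (hg : ∀ n, 1 ≤ n → ∫⁻ x, g (d n i x) ∂μ = Γ) {N : ℕ} (hN : 1 ≤ N) :
    (1 - Γ) * ∑ n ∈ Finset.Ico 1 N,
      ∫⁻ x, (if i ∈ p n x then delayWeight g d p i n x else 0) ∂μ ≤ 1 := by
  suffices h : ∫⁻ x, delayWeight g d p i N x ∂μ + (1 - Γ) * ∑ n ∈ Finset.Ico 1 N,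
      ∫⁻ x, (if i ∈ p n x then delayWeight g d p i n x else 0) ∂μ = 1 from
    le_add_self.trans h.le
  induction N, hN using Nat.le_induction with
  | base => simp [delayWeight]
  | succ n hn ih =>
    have hset := ℱ.le n _ (measurableSet_mem_path (hp n hn) i)
    have hZ := (measurable_delayWeight hd hp g i n).mono (ℱ.le n) le_rfl
    have hsplit : ∫⁻ x, delayWeight g d p i n x ∂μ =
        ∫⁻ x, (if i ∈ p n x then 0 else delayWeight g d p i n x) ∂μ +
          ∫⁻ x, (if i ∈ p n x then delayWeight g d p i n x else 0) ∂μ := by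
      rw [← lintegral_add_left (Measurable.ite hset measurable_const hZ)]
      refine lintegral_congr fun x => ?_
      split_ifs <;> simp
    rw [Finset.sum_Ico_succ_top hn, lintegral_delayWeight_succ hd hp g i hn, hg n hn]
    rw [hsplit] at ih
    set A := ∫⁻ x, (if i ∈ p n x then delayWeight g d p i n x else 0) ∂μ
    have hA : A = A * Γ + (1 - Γ) * A := by
      rw [mul_comm A Γ, ← add_mul, add_tsub_cancel_of_le hΓ, one_mul]
    refine Eq.trans ?_ ih
    conv_rhs => rw [hA]
    ring

open Classical in
/-- Expected number of packets routed through a link while its empirical success probability is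
undefined or overestimated by a factor `1 + ε`. -/
theorem sum_measure_overestimated_le (hd : IsGeometricDelays μ ℱ θ d)
    (hp : ∀ n, 1 ≤ n → ∀ q, MeasurableSet[ℱ n] {x | p n x = q})
    (hθ : ∀ i, 0 < θ i ∧ θ i ≤ 1) {ε : ℝ} (hε : 0 < ε) (hε1 : ε < 1) (i : E) {N : ℕ}
    (hN : 1 ≤ N) :
    ∑ n ∈ Finset.Ico 1 N, ∫⁻ x, (if i ∈ p n x ∧ (packetCount p n i x = 0 ∨
      (1 + ε) * θ i < empiricalRate d p n i x) then 1 else 0) ∂μ ≤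
        ENNReal.ofReal (2 / (ε ^ 2 * θ i ^ 2)) := by
  obtain ⟨hθ0, hθ1⟩ := hθ i
  have hx0 : 0 < ε ^ 2 * θ i ^ 2 := by positivity
  have hx1 : ε ^ 2 * θ i ^ 2 ≤ 1 :=
    mul_le_one₀ (pow_le_one₀ hε.le hε1.le) (by positivity) (pow_le_one₀ hθ0.le hθ1)
  -- It suffices to find weights of mean `Γ` whose products are at least one on the event.
  have key : ∀ (g : ℕ → ℝ≥0∞) (Γ : ℝ), 0 ≤ Γ → ε ^ 2 * θ i ^ 2 / 2 ≤ 1 - Γ →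
      (∀ n, 1 ≤ n → ∫⁻ x, g (d n i x) ∂μ = ENNReal.ofReal Γ) →
      (∀ᵐ x ∂μ, ∀ n, 1 ≤ n → (packetCount p n i x = 0 ∨
        (1 + ε) * θ i < empiricalRate d p n i x) → 1 ≤ delayWeight g d p i n x) →
      ∑ n ∈ Finset.Ico 1 N, ∫⁻ x, (if i ∈ p n x ∧ (packetCount p n i x = 0 ∨
        (1 + ε) * θ i < empiricalRate d p n i x) then 1 else 0) ∂μ ≤
        ENNReal.ofReal (2 / (ε ^ 2 * θ i ^ 2)) := by
    intro g Γ hΓ0 hΓ hg hw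
    have h1 := sum_lintegral_delayWeight_le hd hp
      (ENNReal.ofReal_le_one.2 (by linarith)) hg hN
    have h2 : ENNReal.ofReal (ε ^ 2 * θ i ^ 2 / 2) ≤ 1 - ENNReal.ofReal Γ := by
      rw [← ENNReal.ofReal_one, ← ENNReal.ofReal_sub _ hΓ0]
      exact ENNReal.ofReal_le_ofReal hΓ
    have h3 : ∑ n ∈ Finset.Ico 1 N, ∫⁻ x, (if i ∈ p n x ∧ (packetCount p n i x = 0 ∨
        (1 + ε) * θ i < empiricalRate d p n i x) then 1 else 0) ∂μ ≤
        ∑ n ∈ Finset.Ico 1 N,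
          ∫⁻ x, (if i ∈ p n x then delayWeight g d p i n x else 0) ∂μ := by
      refine Finset.sum_le_sum fun n hn => lintegral_mono_ae ?_
      filter_upwards [hw] with x hx
      by_cases hi : i ∈ p n x
      · simp only [hi, true_and, if_true]
        split_ifs with hbad
        · exact hx n (Finset.mem_Ico.1 hn).1 hbad
        · exact zero_le
      · simp [hi]
    refine h3.trans ?_
    have h4 : ENNReal.ofReal (2 / (ε ^ 2 * θ i ^ 2)) =
        (ENNReal.ofReal (ε ^ 2 * θ i ^ 2 / 2))⁻¹ := by
      rw [← ENNReal.ofReal_inv_of_pos (by positivity), inv_div]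
    rw [h4, ENNReal.le_inv_iff_mul_le, mul_comm]
    exact (mul_le_mul_left h2 _).trans h1
  by_cases hb : (1 + ε) * θ i < 1
  · have hθb : θ i ≤ (1 + ε) * θ i := by nlinarith
    have hγ0 : 0 < tiltFactor (θ i) ((1 + ε) * θ i) := Real.exp_pos _
    refine key (tiltedWeight (tiltFactor (θ i) ((1 + ε) * θ i)) (θ i) ((1 + ε) * θ i))
      (tiltFactor (θ i) ((1 + ε) * θ i)) hγ0.le ?_ ?_ ?_
    · have := tiltFactor_le hθ0 hε hb
      have := half_le_one_sub_exp_neg hx0.le hx1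
      linarith
    · exact fun n hn => hd.lintegral_tiltedWeight hθ hn (by linarith) hγ0.le (by linarith) hb
    · filter_upwards [hd.ae_one_le hθ] with x hx n hn hbad
      rw [delayWeight_tiltedWeight hγ0.le hθ0 (by linarith) (by linarith) hb (hx i) hn,
        ENNReal.one_le_ofReal]
      have hst := packetCount_le_attemptCount (p := p) (hx i) n
      refine one_le_tiltFactor_pow_mul_likelihoodRatio hθ0 hθb hb hst ?_
      rcases hbad with h0 | hgt
      · simp [attemptCount_eq_zero h0, h0]
      · rw [empiricalRate] at hgt
        have ht : (0 : ℝ) < attemptCount d p n i x := by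
          rcases (Nat.cast_nonneg (α := ℝ) (attemptCount d p n i x)).eq_or_lt with h | h
          · rw [← h, div_zero] at hgt
            linarith
          · exact h
        rw [lt_div_iff₀ ht] at hgt
        linarith
  · -- An empirical success probability never exceeds one: only the first packet counts.
    push Not at hb
    refine key (fun _ => 0) 0 le_rfl (by linarith) (by simp) ?_
    filter_upwards [hd.ae_one_le hθ] with x hx n hn hbad
    rcases hbad with h0 | hgt
    · refine le_of_eq (Eq.symm (Finset.prod_eq_one fun m hm => ?_))
      rw [if_neg (notMem_of_packetCount_eq_zero h0 hm)]
    · exfalso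
      have : empiricalRate d p n i x ≤ 1 := by
        refine div_le_one_of_le₀ ?_ (Nat.cast_nonneg _)
        exact_mod_cast packetCount_le_attemptCount (p := p) (hx i) n
      linarith

/-- The mixture of likelihood ratios over `r ∈ (0, θ i)` has expectation `θ i`, by Tonelli. -/
theorem lintegral_lintegral_likelihoodRatio (hd : IsGeometricDelays μ ℱ θ d)
    (hp : ∀ n, 1 ≤ n → ∀ q, MeasurableSet[ℱ n] {x | p n x = q})
    (hθ : ∀ i, 0 < θ i ∧ θ i ≤ 1) {i : E} (hθ1 : θ i < 1) {n : ℕ} (hn : 1 ≤ n) :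
    ∫⁻ x, (∫⁻ r in Set.Ioo 0 (θ i), ENNReal.ofReal (likelihoodRatio (θ i) r
      (packetCount p n i x) (attemptCount d p n i x))) ∂μ = ENNReal.ofReal (θ i) := by
  classical
  have hcount := measurable_packetCount hp n i
  have hatt := measurable_attemptCount hd hp n i
  rw [lintegral_lintegral_swap]
  · have h1 : ∀ r ∈ Set.Ioo 0 (θ i), ∫⁻ x, ENNReal.ofReal (likelihoodRatio (θ i) r
        (packetCount p n i x) (attemptCount d p n i x)) ∂μ = 1 := by
      intro r hr
      have hg := fun m (hm : 1 ≤ m) => hd.lintegral_tiltedWeight hθ hm hθ1 zero_le_one hr.1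
        (hr.2.trans hθ1)
      rw [ENNReal.ofReal_one] at hg
      rw [← lintegral_delayWeight_eq_one hd hp hg hn]
      refine lintegral_congr_ae ?_
      filter_upwards [hd.ae_one_le hθ] with x hx
      rw [delayWeight_tiltedWeight zero_le_one (hθ i).1 hθ1 hr.1 (hr.2.trans hθ1) (hx i) hn,
        one_pow, one_mul]
    rw [setLIntegral_congr_fun measurableSet_Ioo h1]
    simp
  · refine Measurable.aemeasurable ?_
    unfold likelihoodRatio Function.uncurry
    refine ENNReal.measurable_ofReal.comp (Measurable.mul ?_ ?_)
    · exact (measurable_snd.div_const _).pow (hcount.comp measurable_fst)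
    · exact ((measurable_const.sub measurable_snd).div_const _).pow
        (((hatt.sub hcount)).comp measurable_fst)

/-- Expected excess of the index over the mean delay at round `n`. -/
theorem lintegral_linkIndex_sub_le (hd : IsGeometricDelays μ ℱ θ d)
    (hp : ∀ n, 1 ≤ n → ∀ q, MeasurableSet[ℱ n] {x | p n x = q})
    (hθ : ∀ i, 0 < θ i ∧ θ i ≤ 1) (i : E) {n : ℕ} (hn : 3 ≤ n) :
    ∫⁻ x, ENNReal.ofReal (linkIndex d p n i x - 1 / θ i) ∂μ ≤
      ENNReal.ofReal (4 / θ i * (1 / (Real.exp (klsrLevel n) - 1))) := by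
  obtain ⟨hθ0, hθ1⟩ := hθ i
  have hf := one_le_klsrLevel hn
  have hexp : 0 < Real.exp (klsrLevel n) - 1 := by
    have := Real.add_one_le_exp (klsrLevel n)
    linarith
  have h1θ : 1 ≤ 1 / θ i := by rwa [le_div_iff₀ hθ0, one_mul]
  have hno : ∀ x, packetCount p n i x = 0 →
      ENNReal.ofReal (linkIndex d p n i x - 1 / θ i) = 0 := by
    intro x h0
    rw [ENNReal.ofReal_eq_zero, linkIndex, attemptCount_eq_zero h0]
    linarith [edgeIndex_zero_attempts_le n (empiricalRate d p n i x)]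
  rcases hθ1.lt_or_eq with hlt | heq
  · calc ∫⁻ x, ENNReal.ofReal (linkIndex d p n i x - 1 / θ i) ∂μ
        ≤ ∫⁻ x, ENNReal.ofReal (4 / (θ i ^ 2 * (Real.exp (klsrLevel n) - 1))) *
          (∫⁻ r in Set.Ioo 0 (θ i), ENNReal.ofReal (likelihoodRatio (θ i) r
            (packetCount p n i x) (attemptCount d p n i x))) ∂μ := by
          refine lintegral_mono_ae ?_
          filter_upwards [hd.ae_one_le hθ] with x hx
          rcases Nat.eq_zero_or_pos (packetCount p n i x) with h0 | h0
          · rw [hno x h0]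
            exact zero_le
          · exact ofReal_edgeIndex_sub_le h0 (packetCount_le_attemptCount (hx i) n) hθ0 hlt hf
      _ = ENNReal.ofReal (4 / (θ i ^ 2 * (Real.exp (klsrLevel n) - 1))) *
          ENNReal.ofReal (θ i) := by
          rw [lintegral_const_mul' _ _ ENNReal.ofReal_ne_top,
            lintegral_lintegral_likelihoodRatio hd hp hθ hlt (by omega)]
      _ = _ := by
          rw [← ENNReal.ofReal_mul (by positivity)]
          congr 1
          field_simp
  · -- When `θ i = 1` all delays equal one, and the index equals one as well.
    have hone : ∀ᵐ x ∂μ, ∀ m, 1 ≤ m → d m i x = 1 := by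
      rw [ae_all_iff]
      intro m
      by_cases hm : 1 ≤ m
      · have hlaw : μ {x | d m i x = 1} = 1 := by
          have := hd.law m hm i 0
          simpa [heq] using this
        have hmeas : MeasurableSet {x | d m i x = 1} :=
          hd.measurable hm i (measurableSet_singleton 1)
        filter_upwards [(prob_compl_eq_zero_iff hmeas).2 hlaw |> measure_eq_zero_iff_ae_notMem.1]
          with x hx _
        simpa using hx
      · exact ae_of_all _ fun x h => absurd h hm
    refine le_trans (le_of_eq ?_) zero_le
    refine (lintegral_congr_ae (g := fun _ => 0) ?_).trans lintegral_zero
    filter_upwards [hone] with x hx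
    rcases Nat.eq_zero_or_pos (packetCount p n i x) with h0 | h0
    · exact hno x h0
    · have hst : attemptCount d p n i x = packetCount p n i x := by
        refine Finset.sum_congr rfl fun m hm => ?_
        rw [hx m (Finset.mem_Ico.1 hm).1]
      have hrate : empiricalRate d p n i x = 1 := by
        rw [empiricalRate, hst, div_self (by exact_mod_cast h0.ne')]
      refine ENNReal.ofReal_eq_zero.2 ?_
      rw [linkIndex, hrate, heq]
      linarith [edgeIndex_le_of_pos (n := n) (t := attemptCount d p n i x) one_pos le_rfl]

end Delays

/-! ### Gaps of a network -/

namespace Network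

section Gaps

variable {V E : Type*} {G : Network V E}

theorem IsWalk.eq_nil_or_mem {l : List E} {u v : V} (h : G.IsWalk u l v) :
    l = [] ∨ v ∈ l.map G.head := by
  induction l generalizing u with
  | nil => exact Or.inl rfl
  | cons e l ih =>
    right
    rcases ih h.2 with rfl | hv
    · have : G.head e = v := h.2
      simp [this]
    · exact List.mem_cons_of_mem _ hv

variable [Fintype E] {θ : E → ℝ}

/-- If the empty set of links is a path, the source is the destination and there is no other
path. -/
theorem eq_empty_of_empty_mem_paths (h : ∅ ∈ G.paths) {q : Finset E} (hq : q ∈ G.paths) :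
    q = ∅ := by
  classical
  simp only [paths, Finset.mem_filter, Finset.mem_univ, true_and] at h hq
  obtain ⟨l, hl, hl0⟩ := h
  obtain ⟨l', hl', hl'q⟩ := hq
  have hnil : l = [] := by
    cases l with
    | nil => rfl
    | cons e l => simp at hl0
  subst hnil
  have hsd : G.source = G.dest := hl.1
  rcases hl'.1.eq_nil_or_mem with rfl | hmem
  · rw [← hl'q]
    simp
  · exfalso
    rw [← hsd] at hmem
    exact (List.nodup_cons.1 hl'.2).1 hmem

theorem optDelay_le {q : Finset E} (hq : q ∈ G.paths) : G.optDelay θ ≤ meanDelay θ q :=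
  csInf_le ((Set.toFinite _).image _).bddBelow ⟨q, hq, rfl⟩

theorem exists_meanDelay_eq_optDelay (h : G.paths.Nonempty) :
    ∃ q ∈ G.paths, meanDelay θ q = G.optDelay θ := by
  obtain ⟨q, hq, h⟩ := Set.Nonempty.csInf_mem (s := meanDelay θ '' (G.paths : Set (Finset E)))
    ((Finset.coe_nonempty.2 h).image _) ((Set.toFinite _).image _)
  exact ⟨q, hq, h⟩

theorem gap_nonneg {q : Finset E} (hq : q ∈ G.paths) : 0 ≤ G.gap θ q :=
  sub_nonneg.2 (optDelay_le hq)

theorem finite_gaps (G : Network V E) (θ : E → ℝ) :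
    {x | ∃ p ∈ G.paths, x = G.gap θ p ∧ x ≠ 0}.Finite := by
  refine (G.paths.finite_toSet.image (G.gap θ)).subset ?_
  rintro x ⟨p, hp, rfl, -⟩
  exact ⟨p, hp, rfl⟩

theorem minGap_le {q : Finset E} (hq : q ∈ G.paths) (h : G.gap θ q ≠ 0) :
    G.minGap θ ≤ G.gap θ q :=
  csInf_le (finite_gaps G θ).bddBelow ⟨q, hq, rfl, h⟩

theorem exists_gap_eq_minGap (h : ∃ q ∈ G.paths, G.gap θ q ≠ 0) :
    ∃ q ∈ G.paths, G.gap θ q = G.minGap θ ∧ 0 < G.minGap θ := by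
  obtain ⟨q, hq, hne⟩ := h
  obtain ⟨q', hq', h1, h2⟩ := Set.Nonempty.csInf_mem
    (s := {x | ∃ p ∈ G.paths, x = G.gap θ p ∧ x ≠ 0}) ⟨_, q, hq, rfl, hne⟩ (finite_gaps G θ)
  refine ⟨q', hq', h1.symm, lt_of_le_of_ne ?_ h2.symm⟩
  change 0 ≤ sInf _
  rw [h1]
  exact gap_nonneg hq'

theorem card_le_maxLength {q : Finset E} (hq : q ∈ G.paths) : q.card ≤ G.maxLength :=
  Finset.le_sup (f := Finset.card) hq

theorem maxLength_le_card : G.maxLength ≤ Fintype.card E :=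
  Finset.sup_le fun q _ => Finset.card_le_univ q

theorem nonempty_of_mem_paths (h : ∃ q ∈ G.paths, G.gap θ q ≠ 0) {q : Finset E}
    (hq : q ∈ G.paths) : q.Nonempty := by
  rw [Finset.nonempty_iff_ne_empty]
  rintro rfl
  obtain ⟨q', hq', hne⟩ := h
  obtain ⟨q'', hq'', hopt⟩ := exists_meanDelay_eq_optDelay (G := G) (θ := θ) ⟨_, hq'⟩
  rw [eq_empty_of_empty_mem_paths hq hq''] at hopt
  rw [eq_empty_of_empty_mem_paths hq hq', gap, hopt, sub_self] at hne
  exact hne rfl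

theorem optDelay_pos (hθ : ∀ i, 0 < θ i ∧ θ i ≤ 1) (h : ∃ q ∈ G.paths, G.gap θ q ≠ 0) :
    0 < G.optDelay θ := by
  obtain ⟨q, hq, hopt⟩ := exists_meanDelay_eq_optDelay (G := G) (θ := θ)
    (h.imp fun _ hq => hq.1)
  rw [← hopt]
  exact Finset.sum_pos (fun i _ => one_div_pos.2 (hθ i).1) (nonempty_of_mem_paths h hq)

theorem iInf_le_success (θ : E → ℝ) (i : E) : ⨅ i, θ i ≤ θ i :=
  ciInf_le (Set.finite_range θ).bddBelow i

theorem iInf_success_pos [Nonempty E] (hθ : ∀ i, 0 < θ i ∧ θ i ≤ 1) : 0 < ⨅ i, θ i := by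
  obtain ⟨i, hi⟩ := exists_eq_ciInf_of_finite (f := θ)
  rw [← hi]
  exact (hθ i).1

theorem meanDelay_le [Nonempty E] (hθ : ∀ i, 0 < θ i ∧ θ i ≤ 1) {q : Finset E}
    (hq : q ∈ G.paths) : meanDelay θ q ≤ G.maxLength * (⨅ i, θ i)⁻¹ := by
  have hpos := iInf_success_pos hθ
  have h1 : meanDelay θ q ≤ q.card • (⨅ i, θ i)⁻¹ := by
    refine Finset.sum_le_card_nsmul _ _ _ fun i _ => ?_
    rw [one_div]
    exact inv_anti₀ hpos (iInf_le_success θ i)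
  rw [nsmul_eq_mul] at h1
  refine h1.trans ?_
  gcongr
  exact card_le_maxLength hq

theorem gap_le [Nonempty E] (hθ : ∀ i, 0 < θ i ∧ θ i ≤ 1) {q : Finset E}
    (hq : q ∈ G.paths) : G.gap θ q ≤ G.maxLength * (⨅ i, θ i)⁻¹ := by
  have h1 : 0 ≤ G.optDelay θ := by
    obtain ⟨q', _, h⟩ := exists_meanDelay_eq_optDelay (G := G) (θ := θ) ⟨q, hq⟩
    rw [← h]
    exact Finset.sum_nonneg fun i _ => (one_div_pos.2 (hθ i).1).le
  have := meanDelay_le hθ hq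
  rw [gap]
  linarith

end Gaps

end Network

/-! ### Decomposition of the regret -/

section Regret

variable {V E Ω : Type*} [Fintype E] {G : Network V E} {θ : E → ℝ} {d : ℕ → E → Ω → ℕ}
  {p : ℕ → Ω → Finset E}

/-- A minimizer of the sum of the indexes has a gap controlled by the index excesses on an optimal
path and by the confidence widths on its own links, unless one of its links is unexplored or
overestimated. Subtracting `minGap / maxLength` from each width costs only a factor two. -/
theorem gap_le_of_not_overestimated {n : ℕ} {x : Ω} (hθ : ∀ i, 0 < θ i ∧ θ i ≤ 1)
    (hgap : ∃ q ∈ G.paths, G.gap θ q ≠ 0) {ε : ℝ} (hε : 0 < ε)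
    (hεΔ : ε < G.minGap θ / G.optDelay θ) (hpn : p n x ∈ G.paths)
    (hne : G.gap θ (p n x) ≠ 0) {q : Finset E} (hq : Network.meanDelay θ q = G.optDelay θ)
    (hmin : ∑ i ∈ p n x, linkIndex d p n i x ≤ ∑ i ∈ q, linkIndex d p n i x)
    (hx : ∀ i m, 1 ≤ m → 1 ≤ d m i x)
    (hgood : ∀ i ∈ p n x, packetCount p n i x ≠ 0 ∧ empiricalRate d p n i x ≤ (1 + ε) * θ i)
    {ρ f : ℝ} (hρ : ρ = (1 + ε) / (1 - ε * G.optDelay θ / G.minGap θ)) (hf : klsrLevel n ≤ f) :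
    G.gap θ (p n x) ≤ 2 * ρ * ∑ i ∈ q, max (linkIndex d p n i x - 1 / θ i) 0 +
      ∑ i ∈ p n x, max (2 * ρ * Real.sqrt (f / (2 * θ i ^ 3)) / Real.sqrt (packetCount p n i x) -
        G.minGap θ / G.maxLength) 0 := by
  obtain ⟨-, -, -, hΔ⟩ := Network.exists_gap_eq_minGap hgap
  have hD := Network.optDelay_pos hθ hgap
  set Δ := G.minGap θ
  set D := G.optDelay θ with hD_def
  set P := p n x
  have hslack : 0 < 1 - ε * D / Δ := by
    rw [lt_div_iff₀ hD] at hεΔ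
    rw [sub_pos, div_lt_one hΔ]
    exact hεΔ
  have hρ0 : 0 < ρ := by rw [hρ]; positivity
  have hΔle : Δ ≤ G.gap θ P := Network.minGap_le hpn hne
  set X := ∑ i ∈ q, max (linkIndex d p n i x - 1 / θ i) 0
  set w : E → ℝ := fun i => Real.sqrt (f / (2 * θ i ^ 3)) / Real.sqrt (packetCount p n i x)
  have h1 : Network.meanDelay θ P / (1 + ε) ≤ ∑ i ∈ P, linkIndex d p n i x + ∑ i ∈ P, w i := by
    rw [Network.meanDelay, Finset.sum_div, ← Finset.sum_add_distrib]
    refine Finset.sum_le_sum fun i hi => ?_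
    obtain ⟨hs, hrate⟩ := hgood i hi
    have hθ0 := (hθ i).1
    have h2 := one_div_sub_edgeIndex_le (n := n) (Nat.pos_of_ne_zero hs)
      (packetCount_le_attemptCount (p := p) (hx i) n) hθ0
      (by nlinarith : θ i ≤ (1 + ε) * θ i) hrate
    have h3 : Real.sqrt (klsrLevel n / (2 * θ i ^ 3)) / Real.sqrt (packetCount p n i x) ≤ w i := by
      simp only [w]
      gcongr
    have h4 : 1 / θ i / (1 + ε) = 1 / ((1 + ε) * θ i) := by
      rw [div_div, mul_comm]
    rw [h4, linkIndex, empiricalRate]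
    linarith
  have h2 : ∑ i ∈ q, linkIndex d p n i x ≤ D + X := by
    rw [← hq, Network.meanDelay, ← Finset.sum_add_distrib]
    refine Finset.sum_le_sum fun i _ => ?_
    linarith [le_max_left (linkIndex d p n i x - 1 / θ i) 0]
  have h3 : (G.gap θ P - ε * D) / (1 + ε) ≤ X + ∑ i ∈ P, w i := by
    have : (G.gap θ P - ε * D) / (1 + ε) = Network.meanDelay θ P / (1 + ε) - D := by
      rw [Network.gap, ← hD_def]
      field_simp
      ring
    rw [this]
    linarith
  have h4 : G.gap θ P * (1 - ε * D / Δ) ≤ G.gap θ P - ε * D := by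
    have : ε * D ≤ G.gap θ P * (ε * D / Δ) := by
      rw [mul_div_assoc', le_div_iff₀ hΔ, mul_comm]
      gcongr
    linarith
  have h5 : G.gap θ P ≤ ρ * (X + ∑ i ∈ P, w i) := by
    have h6 : G.gap θ P * (1 - ε * D / Δ) / (1 + ε) ≤ X + ∑ i ∈ P, w i :=
      (div_le_div_of_nonneg_right h4 (by linarith)).trans h3
    rw [div_le_iff₀ (by linarith), ← le_div_iff₀ hslack] at h6
    refine h6.trans (le_of_eq ?_)
    rw [hρ]
    ring
  have h6 : ∑ i ∈ P, Δ / G.maxLength ≤ Δ := by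
    rw [Finset.sum_const, nsmul_eq_mul, mul_div_assoc', mul_comm]
    refine div_le_of_le_mul₀ (Nat.cast_nonneg _) hΔ.le ?_
    gcongr
    exact Network.card_le_maxLength hpn
  have h7 : 2 * ρ * ∑ i ∈ P, w i - ∑ i ∈ P, Δ / G.maxLength ≤
      ∑ i ∈ P, max (2 * ρ * Real.sqrt (f / (2 * θ i ^ 3)) / Real.sqrt (packetCount p n i x) -
        Δ / G.maxLength) 0 := by
    rw [Finset.mul_sum, ← Finset.sum_sub_distrib]
    refine Finset.sum_le_sum fun i _ => ?_
    rw [mul_div_assoc]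
    exact le_max_left _ _
  linarith

variable [mΩ : MeasurableSpace Ω] {μ : Measure Ω} {ℱ : Filtration ℕ mΩ}

theorem measurable_comp_path (hp : ∀ n, 1 ≤ n → ∀ q, MeasurableSet[ℱ n] {x | p n x = q})
    {n : ℕ} (hn : 1 ≤ n) (F : Finset E → ℝ) : Measurable fun x => F (p n x) := by
  intro s _
  have : (fun x => F (p n x)) ⁻¹' s = ⋃ q ∈ F ⁻¹' s, {x | p n x = q} := by
    ext x
    simp
  rw [this]
  exact MeasurableSet.biUnion (Set.to_countable _) fun q _ => ℱ.le n _ (hp n hn q)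

variable [IsProbabilityMeasure μ]

theorem integrable_comp_path (hp : ∀ n, 1 ≤ n → ∀ q, MeasurableSet[ℱ n] {x | p n x = q})
    {n : ℕ} (hn : 1 ≤ n) (F : Finset E → ℝ) : Integrable (fun x => F (p n x)) μ := by
  refine Integrable.of_bound (measurable_comp_path hp hn F).aestronglyMeasurable
    (∑ q, ‖F q‖) (ae_of_all _ fun x => ?_)
  exact Finset.single_le_sum (f := fun q => ‖F q‖) (fun q _ => norm_nonneg _)
    (Finset.mem_univ (p n x))

open Classical in
/-- The expected delay of a link on the path of packet `n`, by independence. -/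
theorem integral_ite_delay (hd : IsGeometricDelays μ ℱ θ d)
    (hp : ∀ n, 1 ≤ n → ∀ q, MeasurableSet[ℱ n] {x | p n x = q})
    (hθ : ∀ i, 0 < θ i ∧ θ i ≤ 1) {n : ℕ} (hn : 1 ≤ n) (i : E) :
    Integrable (fun x => if i ∈ p n x then (d n i x : ℝ) else 0) μ ∧
      ∫ x, (if i ∈ p n x then (d n i x : ℝ) else 0) ∂μ =
        ∫ x, (if i ∈ p n x then 1 / θ i else 0) ∂μ := by
  have hset := measurableSet_mem_path (hp n hn) i
  have hY : Measurable[ℱ n] fun x => if i ∈ p n x then (1 : ℝ≥0∞) else 0 :=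
    Measurable.ite hset measurable_const measurable_const
  have hmeas : Measurable fun x => if i ∈ p n x then (d n i x : ℝ) else 0 :=
    Measurable.ite (ℱ.le n _ hset)
      ((measurable_of_countable fun k : ℕ => (k : ℝ)).comp (hd.measurable hn i)) measurable_const
  have hnn : ∀ x, (0 : ℝ) ≤ if i ∈ p n x then (d n i x : ℝ) else 0 := fun x => by
    split_ifs <;> positivity
  have hlint : ∫⁻ x, ENNReal.ofReal (if i ∈ p n x then (d n i x : ℝ) else 0) ∂μ =
      ∫⁻ x, ENNReal.ofReal (if i ∈ p n x then 1 / θ i else 0) ∂μ := by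
    have h1 := hd.lintegral_mul_comp hn i hY (fun k => (k : ℝ≥0∞))
    rw [hd.lintegral_delay hθ hn i, ← lintegral_mul_const _ (hY.mono (ℱ.le n) le_rfl)] at h1
    calc _ = ∫⁻ x, (if i ∈ p n x then (1 : ℝ≥0∞) else 0) * (d n i x : ℝ≥0∞) ∂μ := by
          refine lintegral_congr fun x => ?_
          split_ifs <;> simp
      _ = _ := h1
      _ = _ := by
          refine lintegral_congr fun x => ?_
          split_ifs <;> simp
  have hint := integrable_comp_path (μ := μ) hp hn (fun q => if i ∈ q then 1 / θ i else 0)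
  have hnn' : ∀ x, (0 : ℝ) ≤ if i ∈ p n x then 1 / θ i else 0 := fun x => by
    have := (one_div_pos.2 (hθ i).1).le
    split_ifs
    exacts [this, le_rfl]
  refine ⟨⟨hmeas.aestronglyMeasurable, ?_⟩, ?_⟩
  · rw [hasFiniteIntegral_iff_ofReal (ae_of_all _ hnn), hlint,
      ← hasFiniteIntegral_iff_ofReal (ae_of_all _ hnn')]
    exact hint.2
  · rw [integral_eq_lintegral_of_nonneg_ae (ae_of_all _ hnn) hmeas.aestronglyMeasurable, hlint,
      ← integral_eq_lintegral_of_nonneg_ae (ae_of_all _ hnn') hint.aestronglyMeasurable]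

/-- The regret is the sum of the expected gaps. -/
theorem regret_eq_sum_integral_gap (hd : IsGeometricDelays μ ℱ θ d)
    (hp : ∀ n, 1 ≤ n → ∀ q, MeasurableSet[ℱ n] {x | p n x = q})
    (hθ : ∀ i, 0 < θ i ∧ θ i ≤ 1) (N : ℕ) :
    regret μ G θ d p N = ∑ n ∈ Finset.Icc 1 N, ∫ x, G.gap θ (p n x) ∂μ := by
  classical
  have hround : ∀ n ∈ Finset.Icc 1 N, Integrable (fun x => ∑ i ∈ p n x, (d n i x : ℝ)) μ ∧
      ∫ x, ∑ i ∈ p n x, (d n i x : ℝ) ∂μ = ∫ x, Network.meanDelay θ (p n x) ∂μ := by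
    intro n hn
    have hn1 := (Finset.mem_Icc.1 hn).1
    have h1 : ∀ g : E → ℝ, ∀ x, ∑ i ∈ p n x, g i = ∑ i, if i ∈ p n x then g i else 0 := by
      intro g x
      rw [Finset.sum_ite_mem, Finset.univ_inter]
    simp_rw [Network.meanDelay, h1]
    refine ⟨integrable_finsetSum _ fun i _ => (integral_ite_delay hd hp hθ hn1 i).1, ?_⟩
    rw [integral_finsetSum _ fun i _ => (integral_ite_delay hd hp hθ hn1 i).1,
      integral_finsetSum _ fun i _ =>
        integrable_comp_path hp hn1 (fun q => if i ∈ q then 1 / θ i else 0)]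
    exact Finset.sum_congr rfl fun i _ => (integral_ite_delay hd hp hθ hn1 i).2
  rw [regret, integral_finsetSum _ fun n hn => (hround n hn).1]
  have h2 : ∀ n ∈ Finset.Icc 1 N, ∫ x, G.gap θ (p n x) ∂μ =
      ∫ x, ∑ i ∈ p n x, (d n i x : ℝ) ∂μ - G.optDelay θ := by
    intro n hn
    rw [(hround n hn).2]
    unfold Network.gap
    rw [integral_sub (integrable_comp_path hp (Finset.mem_Icc.1 hn).1 _) (integrable_const _)]
    simp
  rw [Finset.sum_congr rfl h2, Finset.sum_sub_distrib]
  simp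

theorem regret_nonneg (hd : IsGeometricDelays μ ℱ θ d) (hp : IsKLSR ℱ G d p)
    (hθ : ∀ i, 0 < θ i ∧ θ i ≤ 1) (N : ℕ) : 0 ≤ regret μ G θ d p N := by
  rw [regret_eq_sum_integral_gap hd hp.predictable hθ]
  refine Finset.sum_nonneg fun n hn => integral_nonneg fun x => ?_
  exact Network.gap_nonneg (hp.mem_paths n (Finset.mem_Icc.1 hn).1 x)

end Regret

/-! ### The regret bound -/

section UpperBound

variable {V E Ω : Type*} [Fintype E] {G : Network V E} {θ : E → ℝ} {d : ℕ → E → Ω → ℕ}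
  {p : ℕ → Ω → Finset E}

open Classical in
/-- Upper bound on the gap of packet `n` by four terms: an initial round, an unexplored or
overestimated link on its path, an underestimated link on the optimal path `q`, or links of its
path whose confidence widths are still large. -/
theorem ofReal_gap_le [Nonempty E] {n : ℕ} {x : Ω} (hθ : ∀ i, 0 < θ i ∧ θ i ≤ 1)
    (hgap : ∃ q ∈ G.paths, G.gap θ q ≠ 0) {ε : ℝ} (hε : 0 < ε)
    (hεΔ : ε < G.minGap θ / G.optDelay θ) (hpn : p n x ∈ G.paths) {q : Finset E}
    (hq : Network.meanDelay θ q = G.optDelay θ)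
    (hmin : 3 ≤ n → ∑ i ∈ p n x, linkIndex d p n i x ≤ ∑ i ∈ q, linkIndex d p n i x)
    (hx : ∀ i m, 1 ≤ m → 1 ≤ d m i x)
    {ρ f : ℝ} (hρ : ρ = (1 + ε) / (1 - ε * G.optDelay θ / G.minGap θ)) (hρ0 : 0 < ρ)
    (hf : 3 ≤ n → klsrLevel n ≤ f) :
    ENNReal.ofReal (G.gap θ (p n x)) ≤
      (if n < 3 then ENNReal.ofReal (G.maxLength * (⨅ i, θ i)⁻¹) else 0) +
      (∑ i, ENNReal.ofReal (G.maxLength * (⨅ i, θ i)⁻¹) *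
        (if i ∈ p n x ∧ (packetCount p n i x = 0 ∨ (1 + ε) * θ i < empiricalRate d p n i x)
          then 1 else 0) +
      (∑ i ∈ q, ENNReal.ofReal (2 * ρ) *
        (if n < 3 then 0 else ENNReal.ofReal (linkIndex d p n i x - 1 / θ i)) +
      ∑ i, if i ∈ p n x then ENNReal.ofReal (max
        (2 * ρ * Real.sqrt (f / (2 * θ i ^ 3)) / Real.sqrt (packetCount p n i x) -
          G.minGap θ / G.maxLength) 0) else 0)) := by
  by_cases hn3 : n < 3
  · rw [if_pos hn3]
    exact (ENNReal.ofReal_le_ofReal (Network.gap_le hθ hpn)).trans le_self_add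
  have hn3' : 3 ≤ n := not_lt.1 hn3
  simp only [if_neg hn3, zero_add]
  by_cases hne : G.gap θ (p n x) = 0
  · simp [hne]
  by_cases hbad : ∃ i ∈ p n x, packetCount p n i x = 0 ∨
      (1 + ε) * θ i < empiricalRate d p n i x
  · obtain ⟨i, hi, hbad⟩ := hbad
    refine (ENNReal.ofReal_le_ofReal (Network.gap_le hθ hpn)).trans (le_trans ?_ le_self_add)
    refine le_trans (le_of_eq ?_) (Finset.single_le_sum (fun _ _ => zero_le) (Finset.mem_univ i))
    rw [if_pos ⟨hi, hbad⟩, mul_one]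
  · push Not at hbad
    have h := gap_le_of_not_overestimated hθ hgap hε hεΔ hpn hne hq (hmin hn3') hx hbad hρ
      (hf hn3')
    refine (ENNReal.ofReal_le_ofReal h).trans ((le_trans ENNReal.ofReal_add_le ?_).trans
      le_add_self)
    refine add_le_add ?_ ?_
    · rw [ENNReal.ofReal_mul (by positivity), ← Finset.mul_sum,
        ENNReal.ofReal_sum_of_nonneg fun i _ => le_max_right _ _]
      refine le_of_eq (congrArg _ (Finset.sum_congr rfl fun i _ => ?_))
      rcases le_total (linkIndex d p n i x - 1 / θ i) 0 with h0 | h0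
      · rw [max_eq_right h0, ENNReal.ofReal_of_nonpos h0, ENNReal.ofReal_zero]
      · rw [max_eq_left h0]
    · rw [ENNReal.ofReal_sum_of_nonneg fun i _ => le_max_right _ _, Finset.sum_ite_mem,
        Finset.univ_inter]

variable [mΩ : MeasurableSpace Ω] {μ : Measure Ω} {ℱ : Filtration ℕ mΩ} [IsProbabilityMeasure μ]

/-- Finite-time bound on the regret, before simplification of the constants. -/
theorem regret_le_aux [Nonempty E] (hd : IsGeometricDelays μ ℱ θ d) (hp : IsKLSR ℱ G d p)
    (hθ : ∀ i, 0 < θ i ∧ θ i ≤ 1) (hgap : ∃ q ∈ G.paths, G.gap θ q ≠ 0)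
    {ε : ℝ} (hε : 0 < ε) (hε1 : ε < 1) (hεΔ : ε < G.minGap θ / G.optDelay θ) {N : ℕ} (hN : 3 ≤ N)
    {ρ : ℝ} (hρ : ρ = (1 + ε) / (1 - ε * G.optDelay θ / G.minGap θ)) (hρ0 : 0 < ρ) :
    regret μ G θ d p N ≤ 2 * (G.maxLength * (⨅ i, θ i)⁻¹) +
      (G.maxLength * (⨅ i, θ i)⁻¹ * ∑ i, 2 / (ε ^ 2 * θ i ^ 2) +
      (2 * ρ * (12 * (G.maxLength * (⨅ i, θ i)⁻¹)) +
      ∑ i, (2 * ρ * Real.sqrt (klsrLevel N / (2 * θ i ^ 3))) ^ 2 /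
        (G.minGap θ / G.maxLength))) := by
  classical
  obtain ⟨q, hqP, hq⟩ := Network.exists_meanDelay_eq_optDelay (G := G) (θ := θ)
    (hgap.imp fun _ h => h.1)
  obtain ⟨-, -, -, hΔ⟩ := Network.exists_gap_eq_minGap hgap
  have hpos := Network.iInf_success_pos hθ
  have hH : (0 : ℝ) < G.maxLength := by
    have := (Network.nonempty_of_mem_paths hgap hqP).card_pos
    exact_mod_cast this.trans_le (Network.card_le_maxLength hqP)
  have hp' := hp.predictable
  set c : ℝ := G.maxLength * (⨅ i, θ i)⁻¹
  have hc : 0 < c := by positivity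
  set f := klsrLevel N
  set Δ := G.minGap θ
  set φ : E → ℕ → ℝ := fun i s =>
    max (2 * ρ * Real.sqrt (f / (2 * θ i ^ 3)) / Real.sqrt s - Δ / G.maxLength) 0
  rw [regret_eq_sum_integral_gap hd hp' hθ]
  have hIco : Finset.Icc 1 N = Finset.Ico 1 (N + 1) := by
    ext
    simp
  rw [hIco]
  have htoReal : ∀ n ∈ Finset.Ico 1 (N + 1), ∫ x, G.gap θ (p n x) ∂μ =
      (∫⁻ x, ENNReal.ofReal (G.gap θ (p n x)) ∂μ).toReal := by
    intro n hn
    have hn1 := (Finset.mem_Ico.1 hn).1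
    exact integral_eq_lintegral_of_nonneg_ae
      (ae_of_all _ fun x => Network.gap_nonneg (hp.mem_paths n hn1 x))
      (measurable_comp_path hp' hn1 _).aestronglyMeasurable
  have hfin : ∀ n ∈ Finset.Ico 1 (N + 1), ∫⁻ x, ENNReal.ofReal (G.gap θ (p n x)) ∂μ ≠ ⊤ :=
    fun n hn => (integrable_comp_path hp' (Finset.mem_Ico.1 hn).1 _).lintegral_lt_top.ne
  rw [Finset.sum_congr rfl htoReal, ← ENNReal.toReal_sum hfin]
  have hS : 0 ≤ ∑ i, 2 / (ε ^ 2 * θ i ^ 2) :=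
    Finset.sum_nonneg fun i _ => by positivity
  have hW : 0 ≤ ∑ i, (2 * ρ * Real.sqrt (f / (2 * θ i ^ 3))) ^ 2 / (Δ / G.maxLength) :=
    Finset.sum_nonneg fun i _ => by positivity
  refine ENNReal.toReal_le_of_le_ofReal (by positivity) ?_
  rw [ENNReal.ofReal_add (by positivity) (by positivity),
    ENNReal.ofReal_add (by positivity) (by positivity),
    ENNReal.ofReal_add (by positivity) (by positivity)]
  have hmeasB : ∀ n ∈ Finset.Ico 1 (N + 1), ∀ i, Measurable fun x =>
      (if i ∈ p n x ∧ (packetCount p n i x = 0 ∨ (1 + ε) * θ i < empiricalRate d p n i x)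
        then (1 : ℝ≥0∞) else 0) := by
    intro n hn i
    have hn1 := (Finset.mem_Ico.1 hn).1
    refine Measurable.ite (MeasurableSet.inter (ℱ.le n _ (measurableSet_mem_path (hp' n hn1) i))
      ?_) measurable_const measurable_const
    exact measurableSet_setOfPred.2 (measurable_comp_counts hd hp'
      (fun k => k.1 = 0 ∨ (1 + ε) * θ i < (k.1 : ℝ) / (k.2 : ℝ)) n i)
  have hmeasX : ∀ n i, Measurable fun x =>
      (if n < 3 then 0 else ENNReal.ofReal (linkIndex d p n i x - 1 / θ i)) := fun n i =>
    measurable_comp_counts hd hp' (fun k => if n < 3 then 0 else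
      ENNReal.ofReal (edgeIndex n k.2 ((k.1 : ℝ) / (k.2 : ℝ)) - 1 / θ i)) n i
  have hmeasW : ∀ n ∈ Finset.Ico 1 (N + 1), ∀ i, Measurable fun x =>
      (if i ∈ p n x then ENNReal.ofReal (φ i (packetCount p n i x)) else 0) := fun n hn i =>
    Measurable.ite (ℱ.le n _ (measurableSet_mem_path (hp' n (Finset.mem_Ico.1 hn).1) i))
      (measurable_comp_counts hd hp' (fun k => ENNReal.ofReal (φ i k.1)) n i) measurable_const
  calc ∑ n ∈ Finset.Ico 1 (N + 1), ∫⁻ x, ENNReal.ofReal (G.gap θ (p n x)) ∂μ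
      ≤ ∑ n ∈ Finset.Ico 1 (N + 1), (∫⁻ _, (if n < 3 then ENNReal.ofReal c else 0) ∂μ +
        (∫⁻ x, ∑ i, ENNReal.ofReal c *
          (if i ∈ p n x ∧ (packetCount p n i x = 0 ∨ (1 + ε) * θ i < empiricalRate d p n i x)
            then 1 else 0) ∂μ +
        (∫⁻ x, ∑ i ∈ q, ENNReal.ofReal (2 * ρ) *
          (if n < 3 then 0 else ENNReal.ofReal (linkIndex d p n i x - 1 / θ i)) ∂μ +
        ∫⁻ x, ∑ i, (if i ∈ p n x then ENNReal.ofReal (φ i (packetCount p n i x)) else 0) ∂μ))) := by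
        refine Finset.sum_le_sum fun n hn => ?_
        obtain ⟨hn1, hn2⟩ := Finset.mem_Ico.1 hn
        rw [← lintegral_add_left (Finset.measurable_fun_sum _ fun i _ => (hmeasX n i).const_mul _),
          ← lintegral_add_left
            (Finset.measurable_fun_sum _ fun i _ => (hmeasB n hn i).const_mul _),
          ← lintegral_add_left measurable_const]
        refine lintegral_mono_ae ?_
        filter_upwards [hd.ae_one_le hθ] with x hx
        exact ofReal_gap_le hθ hgap hε hεΔ (hp.mem_paths n hn1 x) hq
          (fun h3 => hp.argmin n h3 x q hqP) hx hρ hρ0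
          (fun h3 => klsrLevel_mono h3 (Nat.lt_succ_iff.1 hn2))
    _ = ∑ n ∈ Finset.Ico 1 (N + 1), ∫⁻ _, (if n < 3 then ENNReal.ofReal c else 0) ∂μ +
        (∑ n ∈ Finset.Ico 1 (N + 1), ∫⁻ x, ∑ i, ENNReal.ofReal c *
          (if i ∈ p n x ∧ (packetCount p n i x = 0 ∨ (1 + ε) * θ i < empiricalRate d p n i x)
            then 1 else 0) ∂μ +
        (∑ n ∈ Finset.Ico 1 (N + 1), ∫⁻ x, ∑ i ∈ q, ENNReal.ofReal (2 * ρ) *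
          (if n < 3 then 0 else ENNReal.ofReal (linkIndex d p n i x - 1 / θ i)) ∂μ +
        ∑ n ∈ Finset.Ico 1 (N + 1), ∫⁻ x,
          ∑ i, (if i ∈ p n x then ENNReal.ofReal (φ i (packetCount p n i x)) else 0) ∂μ)) := by
        simp only [Finset.sum_add_distrib]
    _ ≤ _ := by
        refine add_le_add ?_ (add_le_add ?_ (add_le_add ?_ ?_))
        · simp only [lintegral_const, measure_univ, mul_one]
          rw [← Finset.sum_filter, Finset.sum_const, nsmul_eq_mul,
            ENNReal.ofReal_mul (p := 2) (by norm_num), ENNReal.ofReal_ofNat]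
          gcongr
          have hsub : (Finset.Ico 1 (N + 1)).filter (· < 3) ⊆ {1, 2} := by
            intro k hk
            simp only [Finset.mem_filter, Finset.mem_Ico] at hk
            simp only [Finset.mem_insert, Finset.mem_singleton]
            omega
          exact_mod_cast Finset.card_le_card hsub
        · have h1 : ∀ n ∈ Finset.Ico 1 (N + 1), ∫⁻ x, ∑ i, ENNReal.ofReal c *
              (if i ∈ p n x ∧ (packetCount p n i x = 0 ∨
                (1 + ε) * θ i < empiricalRate d p n i x) then 1 else 0) ∂μ =
              ∑ i, ENNReal.ofReal c * ∫⁻ x, (if i ∈ p n x ∧ (packetCount p n i x = 0 ∨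
                (1 + ε) * θ i < empiricalRate d p n i x) then 1 else 0) ∂μ := by
            intro n hn
            rw [lintegral_finsetSum _ fun i _ => (hmeasB n hn i).const_mul _]
            exact Finset.sum_congr rfl fun i _ => lintegral_const_mul _ (hmeasB n hn i)
          rw [Finset.sum_congr rfl h1, Finset.sum_comm, ENNReal.ofReal_mul hc.le,
            ENNReal.ofReal_sum_of_nonneg fun i _ => by positivity, Finset.mul_sum]
          refine Finset.sum_le_sum fun i _ => ?_
          rw [← Finset.mul_sum]
          gcongr
          exact sum_measure_overestimated_le hd hp' hθ hε hε1 i (by omega)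
        · have h1 : ∀ n ∈ Finset.Ico 1 (N + 1), ∫⁻ x, ∑ i ∈ q, ENNReal.ofReal (2 * ρ) *
              (if n < 3 then 0 else ENNReal.ofReal (linkIndex d p n i x - 1 / θ i)) ∂μ ≤
              ENNReal.ofReal (2 * ρ) * ∑ i ∈ q, (if n < 3 then 0 else ENNReal.ofReal
                (4 / θ i * (1 / (Real.exp (klsrLevel n) - 1)))) := by
            intro n hn
            rw [lintegral_finsetSum _ fun i _ => (hmeasX n i).const_mul _, Finset.mul_sum]
            refine Finset.sum_le_sum fun i _ => ?_
            rw [lintegral_const_mul _ (hmeasX n i)]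
            gcongr
            split_ifs with h3
            · simp
            · exact lintegral_linkIndex_sub_le hd hp' hθ i (not_lt.1 h3)
          refine (Finset.sum_le_sum h1).trans ?_
          rw [← Finset.mul_sum, Finset.sum_comm, ENNReal.ofReal_mul (p := 2 * ρ) (by positivity)]
          gcongr
          have hexp : ∀ n ∈ Finset.Icc 3 N, 0 ≤ 1 / (Real.exp (klsrLevel n) - 1) := by
            intro n hn
            have h2 := Real.add_one_le_exp (klsrLevel n)
            have h3 := one_le_klsrLevel (Finset.mem_Icc.1 hn).1
            exact one_div_nonneg.2 (by linarith)
          have h2 : ∀ i ∈ q, ∑ n ∈ Finset.Ico 1 (N + 1), (if n < 3 then 0 else ENNReal.ofReal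
              (4 / θ i * (1 / (Real.exp (klsrLevel n) - 1)))) ≤
              ENNReal.ofReal (12 * (⨅ i, θ i)⁻¹) := by
            intro i _
            have hθ0 := (hθ i).1
            have hfilter : (Finset.Ico 1 (N + 1)).filter (fun n => ¬ n < 3) = Finset.Icc 3 N := by
              ext k
              simp only [Finset.mem_filter, Finset.mem_Ico, Finset.mem_Icc]
              omega
            rw [Finset.sum_ite, Finset.sum_const_zero, zero_add, hfilter,
              ← ENNReal.ofReal_sum_of_nonneg fun n hn =>
                mul_nonneg (by positivity) (hexp n hn), ← Finset.mul_sum]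
            apply ENNReal.ofReal_le_ofReal
            calc 4 / θ i * ∑ n ∈ Finset.Icc 3 N, 1 / (Real.exp (klsrLevel n) - 1)
                ≤ 4 / θ i * 3 := by
                  gcongr
                  exact sum_one_div_exp_klsrLevel_le N
              _ = 12 * (θ i)⁻¹ := by ring
              _ ≤ 12 * (⨅ i, θ i)⁻¹ := by
                  gcongr
                  exact Network.iInf_le_success θ i
          refine (Finset.sum_le_card_nsmul _ _ _ h2).trans ?_
          rw [nsmul_eq_mul, ← ENNReal.ofReal_natCast, ← ENNReal.ofReal_mul (by positivity)]
          apply ENNReal.ofReal_le_ofReal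
          have hcard : (q.card : ℝ) ≤ G.maxLength := by
            exact_mod_cast Network.card_le_maxLength hqP
          calc (q.card : ℝ) * (12 * (⨅ i, θ i)⁻¹) ≤ G.maxLength * (12 * (⨅ i, θ i)⁻¹) := by
                gcongr
            _ = 12 * (G.maxLength * (⨅ i, θ i)⁻¹) := by ring
        · rw [← lintegral_finsetSum _ fun n hn =>
            Finset.measurable_fun_sum _ fun i _ => hmeasW n hn i]
          rw [ENNReal.ofReal_sum_of_nonneg fun i _ => by positivity]
          have hone : ∀ C : ℝ≥0∞, C = ∫⁻ _, C ∂μ := fun C => by simp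
          rw [hone (∑ i, _)]
          refine lintegral_mono fun x => ?_
          simp only
          rw [Finset.sum_comm]
          refine Finset.sum_le_sum fun i _ => ?_
          rw [sum_ite_packetCount (fun s => ENNReal.ofReal (φ i s)) (by omega),
            ← ENNReal.ofReal_sum_of_nonneg fun s _ => le_max_right _ _]
          exact ENNReal.ofReal_le_ofReal
            (sum_posPart_div_sqrt_sub_le (by positivity) (by positivity) _)

end UpperBound

theorem regret_le {V E Ω : Type*} [Fintype E] [mΩ : MeasurableSpace Ω] {μ : Measure Ω}
    [IsProbabilityMeasure μ] {ℱ : Filtration ℕ mΩ} {G : Network V E} {θ : E → ℝ}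
    {d : ℕ → E → Ω → ℕ} {p : ℕ → Ω → Finset E} (hd : IsGeometricDelays μ ℱ θ d)
    (hp : IsKLSR ℱ G d p) (hθ : ∀ i, 0 < θ i ∧ θ i ≤ 1)
    (hgap : ∃ q ∈ G.paths, G.gap θ q ≠ 0) {ε : ℝ} (hε : 0 < ε) (hε1 : ε < 1)
    (hεΔ : ε < G.minGap θ / G.optDelay θ) {N : ℕ} (hN : 3 ≤ N) :
    regret μ G θ d p N ≤
      45 * regretFactor ε (G.optDelay θ) (G.minGap θ) * Fintype.card E * G.maxLength *
          (Real.log N + 3 * Real.log (Real.log N)) / (G.minGap θ * (⨅ i, θ i) ^ 3) +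
        G.maxLength * (⨅ i, θ i)⁻¹ * (146 + 2 * (ε ^ 2)⁻¹ * ∑ i, (θ i ^ 2)⁻¹) := by
  obtain ⟨q, hq, -, hΔ⟩ := Network.exists_gap_eq_minGap hgap
  have hq0 := Network.nonempty_of_mem_paths hgap hq
  have : Nonempty E := ⟨hq0.choose⟩
  have hD := Network.optDelay_pos hθ hgap
  have hT := Network.iInf_success_pos hθ
  have hT1 : ⨅ i, θ i ≤ 1 := (Network.iInf_le_success θ hq0.choose).trans (hθ _).2
  have hTle := Network.iInf_le_success θ
  have hH1 : (1 : ℝ) ≤ G.maxLength := by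
    exact_mod_cast hq0.card_pos.trans_le (Network.card_le_maxLength hq)
  have hHE : (G.maxLength : ℝ) ≤ Fintype.card E := by
    exact_mod_cast Network.maxLength_le_card
  have hΔH : G.minGap θ ≤ G.maxLength * (⨅ i, θ i)⁻¹ := by
    obtain ⟨q, hq, h, -⟩ := Network.exists_gap_eq_minGap hgap
    rw [← h]
    exact Network.gap_le hθ hq
  have hf1 := one_le_klsrLevel hN
  have hslack : 0 < 1 - ε * G.optDelay θ / G.minGap θ := by
    rw [lt_div_iff₀ hD] at hεΔ
    rw [sub_pos, div_lt_one hΔ]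
    exact hεΔ
  obtain ⟨ρ, hρ⟩ : ∃ ρ, ρ = (1 + ε) / (1 - ε * G.optDelay θ / G.minGap θ) := ⟨_, rfl⟩
  have hρ0 : 0 < ρ := by rw [hρ]; positivity
  have haux := regret_le_aux hd hp hθ hgap hε hε1 hεΔ hN hρ hρ0
  have hM : ρ ^ 2 ≤ regretFactor ε (G.optDelay θ) (G.minGap θ) := by
    rw [hρ, div_pow, regretFactor]
    have h1 : 0 < 1 - ε := by linarith
    have h2 : (1 - ε) ^ 3 ≤ 1 := pow_le_one₀ h1.le (by linarith)
    gcongr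
    exact mul_le_of_le_one_left (by positivity) h2
  rw [show Real.log N + 3 * Real.log (Real.log N) = klsrLevel N from rfl]
  set Δ := G.minGap θ
  set T := ⨅ i, θ i
  set H : ℝ := (G.maxLength : ℝ)
  set n : ℝ := (Fintype.card E : ℝ) with hn
  set f := klsrLevel N
  set M := regretFactor ε (G.optDelay θ) Δ
  have hB : ∑ i, 2 / (ε ^ 2 * θ i ^ 2) = 2 * (ε ^ 2)⁻¹ * ∑ i, (θ i ^ 2)⁻¹ := by
    rw [Finset.mul_sum]
    refine Finset.sum_congr rfl fun i _ => ?_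
    rw [div_eq_mul_inv, mul_inv, mul_assoc]
  have hQ0 : 0 < n * H * f / (Δ * T ^ 3) := by
    have : 0 < n := by linarith
    positivity
  have hW : ∑ i, (2 * ρ * Real.sqrt (f / (2 * θ i ^ 3))) ^ 2 / (Δ / H) ≤
      2 * ρ ^ 2 * (n * H * f / (Δ * T ^ 3)) := by
    have h1 : ∀ i ∈ Finset.univ, (2 * ρ * Real.sqrt (f / (2 * θ i ^ 3))) ^ 2 / (Δ / H) ≤
        2 * ρ ^ 2 * (H * f / (Δ * T ^ 3)) := by
      intro i _
      have hθ0 := (hθ i).1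
      rw [mul_pow, Real.sq_sqrt (by positivity)]
      have h2 : (2 * ρ) ^ 2 * (f / (2 * θ i ^ 3)) / (Δ / H) =
          2 * ρ ^ 2 * (H * f / (Δ * θ i ^ 3)) := by
        field_simp
      rw [h2]
      gcongr
      exact hTle i
    refine (Finset.sum_le_card_nsmul _ _ _ h1).trans (le_of_eq ?_)
    rw [nsmul_eq_mul, Finset.card_univ, ← hn]
    ring
  -- The excess term is linear in `ρ`; its quadratic majorant fits into the leading term.
  have hX : ρ ^ 2 * (H * T⁻¹) ≤ ρ ^ 2 * (n * H * f / (Δ * T ^ 3)) := by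
    gcongr
    rw [le_div_iff₀ (by positivity)]
    have h1 : Δ * T ≤ n := by
      calc Δ * T ≤ H * T⁻¹ * T := by gcongr
        _ = H := by field_simp
        _ ≤ n := hHE
    calc H * T⁻¹ * (Δ * T ^ 3) = H * (Δ * T) * T := by field_simp
      _ ≤ H * n * f := by gcongr; linarith
      _ = n * H * f := by ring
  have hlin : 2 * ρ * (12 * (H * T⁻¹)) ≤ 144 * (H * T⁻¹) + ρ ^ 2 * (H * T⁻¹) := by
    have : 0 < H * T⁻¹ := by positivity
    nlinarith [sq_nonneg (ρ - 12)]
  have hlead : 3 * ρ ^ 2 * (n * H * f / (Δ * T ^ 3)) ≤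
      45 * M * n * H * f / (Δ * T ^ 3) := by
    calc 3 * ρ ^ 2 * (n * H * f / (Δ * T ^ 3)) ≤ 45 * M * (n * H * f / (Δ * T ^ 3)) := by
          gcongr
          nlinarith [sq_nonneg ρ]
      _ = _ := by ring
  rw [hB] at haux
  linarith

theorem regretFactor_le {ε D Δ : ℝ} (hε : 0 < ε) (hε2 : ε ≤ 1 / 2) (hD : 0 < D) (hΔ : 0 < Δ)
    (h : ε ≤ Δ / D / 2) : regretFactor ε D Δ ≤ 72 := by
  have h1 : ε * D / Δ ≤ 1 / 2 := by
    rw [div_div, le_div_iff₀ (by positivity)] at h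
    rw [div_le_iff₀ hΔ]
    linarith
  have h2 : (1 / 2 : ℝ) ^ 3 * (1 / 2) ^ 2 ≤ (1 - ε) ^ 3 * (1 - ε * D / Δ) ^ 2 := by
    have h3 : 0 ≤ 1 - ε := by linarith
    gcongr <;> linarith
  rw [regretFactor, div_le_iff₀ (lt_of_lt_of_le (by norm_num) h2)]
  nlinarith

theorem theorem6 :
    ∃ K C : ℝ, 0 ≤ K ∧ 0 ≤ C ∧
      ∀ (V : Type*) (E : Type*) [Fintype E] (Ω : Type*) [mΩ : MeasurableSpace Ω]
        (μ : Measure Ω) [IsProbabilityMeasure μ]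
        (ℱ : Filtration ℕ mΩ)
        (G : Network V E) (θ : E → ℝ) (d : ℕ → E → Ω → ℕ) (p : ℕ → Ω → Finset E),
        (∀ i, 0 < θ i ∧ θ i ≤ 1) →
        (∃ q ∈ G.paths, G.gap θ q ≠ 0) →
        IsGeometricDelays μ ℱ θ d →
        IsKLSR ℱ G d p →
        (∀ ε : ℝ, 0 < ε → ε < 1 → ε < G.minGap θ / G.optDelay θ → ∀ N : ℕ, 3 ≤ N →
          regret μ G θ d p N ≤
            45 * regretFactor ε (G.optDelay θ) (G.minGap θ) * Fintype.card E * G.maxLength *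
                (Real.log N + 3 * Real.log (Real.log N)) / (G.minGap θ * (⨅ i, θ i) ^ 3) +
              G.maxLength * (⨅ i, θ i)⁻¹ * (K + 2 * (ε ^ 2)⁻¹ * ∑ i, (θ i ^ 2)⁻¹)) ∧
        IsBigOWith (C / (G.minGap θ * (⨅ i, θ i) ^ 3)) atTop
          (fun N : ℕ => regret μ G θ d p N)
          (fun N : ℕ => (Fintype.card E : ℝ) * G.maxLength * Real.log N) := by
  refine ⟨146, 12961, by norm_num, by norm_num, ?_⟩
  intro V E _ Ω mΩ μ _ ℱ G θ d p hθ hgap hd hp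
  refine ⟨fun ε hε hε1 hεΔ N hN => regret_le hd hp hθ hgap hε hε1 hεΔ hN, ?_⟩
  obtain ⟨q, hq, -, hΔ⟩ := Network.exists_gap_eq_minGap hgap
  have hq0 := Network.nonempty_of_mem_paths hgap hq
  have : Nonempty E := ⟨hq0.choose⟩
  have hD := Network.optDelay_pos hθ hgap
  have hT := Network.iInf_success_pos hθ
  have hH : (1 : ℝ) ≤ G.maxLength := by
    exact_mod_cast hq0.card_pos.trans_le (Network.card_le_maxLength hq)
  have hHE : (G.maxLength : ℝ) ≤ Fintype.card E := by
    exact_mod_cast Network.maxLength_le_card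
  set ε : ℝ := min 1 (G.minGap θ / G.optDelay θ) / 2 with hε_def
  have hmin : 0 < min 1 (G.minGap θ / G.optDelay θ) := lt_min one_pos (by positivity)
  have hm1 := min_le_left 1 (G.minGap θ / G.optDelay θ)
  have hm2 := min_le_right 1 (G.minGap θ / G.optDelay θ)
  have hε : 0 < ε := by positivity
  have hM := regretFactor_le hε (by linarith) hD hΔ (by linarith)
  set c : ℝ := G.maxLength * (⨅ i, θ i)⁻¹ * (146 + 2 * (ε ^ 2)⁻¹ * ∑ i, (θ i ^ 2)⁻¹)
  set Q : ℝ := Fintype.card E * G.maxLength / (G.minGap θ * (⨅ i, θ i) ^ 3) with hQ_def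
  have hQ : 0 < Q := by
    have : (0 : ℝ) < Fintype.card E := by linarith
    positivity
  have hlim : Tendsto (fun N : ℕ => Q * Real.log N) atTop atTop :=
    (Real.tendsto_log_atTop.comp tendsto_natCast_atTop_atTop).const_mul_atTop hQ
  rw [isBigOWith_iff]
  filter_upwards [eventually_ge_atTop 3, hlim.eventually_ge_atTop c] with N hN hcN
  have hlog := one_le_log_of_three_le hN
  have hllog : Real.log (Real.log N) ≤ Real.log N := Real.log_le_self (by linarith)
  have hE0 : (0 : ℝ) < Fintype.card E := by linarith
  rw [Real.norm_of_nonneg (regret_nonneg hd hp hθ N), Real.norm_of_nonneg (by positivity)]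
  refine (regret_le hd hp hθ hgap hε (by linarith) (by linarith) hN).trans ?_
  have h1 : 45 * regretFactor ε (G.optDelay θ) (G.minGap θ) * Fintype.card E * G.maxLength *
      (Real.log N + 3 * Real.log (Real.log N)) / (G.minGap θ * (⨅ i, θ i) ^ 3) ≤
        12960 * (Q * Real.log N) := by
    have h2 : 45 * regretFactor ε (G.optDelay θ) (G.minGap θ) * Fintype.card E * G.maxLength *
        (Real.log N + 3 * Real.log (Real.log N)) / (G.minGap θ * (⨅ i, θ i) ^ 3) =
        45 * regretFactor ε (G.optDelay θ) (G.minGap θ) *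
          (Q * (Real.log N + 3 * Real.log (Real.log N))) := by
      rw [hQ_def]
      ring
    have h3 : 0 ≤ Real.log N + 3 * Real.log (Real.log N) := by
      have := Real.log_nonneg hlog
      linarith
    rw [h2]
    calc 45 * regretFactor ε (G.optDelay θ) (G.minGap θ) *
          (Q * (Real.log N + 3 * Real.log (Real.log N)))
        ≤ 45 * 72 * (Q * (4 * Real.log N)) := by
          gcongr
          linarith
      _ = _ := by ring
  calc _ ≤ 12960 * (Q * Real.log N) + Q * Real.log N := add_le_add h1 hcN
    _ = 12961 / (G.minGap θ * (⨅ i, θ i) ^ 3) *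
        (Fintype.card E * G.maxLength * Real.log N) := by
      rw [hQ_def]
      ring
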